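/- Let $n\ge 1$ be an integer, let $\mathbf S^2_n\subset\mathbf R^3$ be the sphere centered at the origin with total surface area $n$ (so its radius is $\sqrt{n/(4\pi)}$), and let $\lambda_n$ be surface area on $\mathbf S^2_n$. Let $\mathcal L\subset\mathbf S^2_n$ be any set of exactly $n$ distinct points. Put $U(x)=\sum_{z\in\mathcal L}\log|x-z|$, where $|\cdot|$ is the Euclidean norm of $\mathbf R^3$, and for $x\in\mathbf S^2_n\setminus\mathcal L$ let $F(x)\in T_x\mathbf S^2_n\subset\mathbf R^3$ be minus the gradient of $U|_{\mathbf S^2_n}$ at $x$ for the metric induced from $\mathbf R^3$. Then: 1. For every $x\in\mathbf S^2_n\setminus\mathcal L$ the equation $\frac{dY_x}{dt}(t)=F(Y_x(t))$, $Y_x(0)=x$, has a unique maximal solution in $\mathbf S^2_n\setminus\mathcal L$, and its domain is $(-\infty,\tau_x)$ for some $0<\tau_x\le\infty$. 2. The function $|F|$ is $\lambda_n$-integrable; for $\lambda_n$-almost every $x$ the function $t\mapsto|F(Y_x(t))|$ is integrable on $(0,\tau_x)$; the function $x\mapsto\int_0^{\tau_x}|F(Y_x(t))|\,dt$ is $\lambda_n$-integrable;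 and $$\frac1n\int_{\mathbf S^2_n}\int_0^{\tau_x}|F(Y_x(t))|\,dt\,d\lambda_n(x)=\frac1{2\pi n}\int_{\mathbf S^2_n}|F(x)|\,d\lambda_n(x).$$ -/

import Mathlib

open MeasureTheory
open scoped RealInnerProductSpace

noncomputable section

namespace GravAlloc

/-- Three-dimensional Euclidean space. -/
abbrev E3 : Type := EuclideanSpace ℝ (Fin 3)

/-- The radius of the sphere of surface area `n`. -/
def radius (n : ℕ) : ℝ := Real.sqrt (n / (4 * Real.pi))

/-- The sphere of surface area `n` centered at the origin. -/
def sphereN (n : ℕ) : Set E3 := Metric.sphere 0 (radius n)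

/-- Surface area `λ_n` on `sphereN n`, as a measure on the ambient space: the surface measure of the
unit sphere (Mathlib's `toSphere` of Lebesgue measure), carried over by the dilation with factor
`radius n` and multiplied by `(radius n) ^ 2`. -/
def area (n : ℕ) : Measure E3 :=
  ENNReal.ofReal (radius n ^ 2) •
    (volume : Measure E3).toSphere.map (fun u : Metric.sphere (0 : E3) 1 => radius n • (u : E3))

/-- The potential `U(x) = ∑_{z ∈ L} log |x - z|`, by its formula on all of the ambient space. -/
def potential (L : Finset E3) (x : E3) : ℝ := ∑ z ∈ L, Real.log ‖x - z‖

/-- The force `F`: minus the gradient of `potential L` along the sphere centered at the origin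
through `x`, for the metric induced by the ambient space, that is, minus the orthogonal projection
of the ambient gradient to the tangent plane `xᗮ`. It is meaningful for `x ∉ L`. -/
def force (L : Finset E3) (x : E3) : E3 :=
  -((Submodule.span ℝ {x})ᗮ.starProjection (gradient (potential L) x))

/-- `γ` restricted to the open interval `I ∋ 0` is a curve in `sphereN n` minus the points of `L`
that starts at `x` and solves `γ' = F(γ)`. -/
structure IsFlowCurve (n : ℕ) (L : Finset E3) (x : E3) (γ : ℝ → E3) (I : Set ℝ) : Prop where
  isOpen : IsOpen I
  ordConnected : I.OrdConnected
  zero_mem : (0 : ℝ) ∈ I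
  initial : γ 0 = x
  mem : ∀ t ∈ I, γ t ∈ sphereN n \ (L : Set E3)
  integralCurve : IsIntegralCurveOn γ (fun _ => force L) I

/-- `γ` on `I` is the maximal integral curve from `x`: every other one is a restriction of it. -/
def IsMaximalFlowCurve (n : ℕ) (L : Finset E3) (x : E3) (γ : ℝ → E3) (I : Set ℝ) : Prop :=
  IsFlowCurve n L x γ I ∧
    ∀ (γ' : ℝ → E3) (I' : Set ℝ), IsFlowCurve n L x γ' I' → I' ⊆ I ∧ Set.EqOn γ' γ I'

/-- The times that some integral curve from `x` reaches. -/
def flowDomain (n : ℕ) (L : Finset E3) (x : E3) : Set ℝ :=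
  {t | ∃ (γ : ℝ → E3) (I : Set ℝ), IsFlowCurve n L x γ I ∧ t ∈ I}

/-- The exit time `τ_x`, possibly `⊤` (and `⊥` if no integral curve starts at `x`). -/
def exitTime (n : ℕ) (L : Finset E3) (x : E3) : EReal :=
  sSup ((fun t : ℝ => (t : EReal)) '' flowDomain n L x)

open Classical in
/-- The trajectory `Y_x(t)`: the value at time `t` of an integral curve from `x` that is defined at
time `t`, and `x` if there is none. -/
def trajectory (n : ℕ) (L : Finset E3) (x : E3) (t : ℝ) : E3 :=
  if h : t ∈ flowDomain n L x then h.choose t else x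

/-- The length `∫_0^{τ_x} |F(Y_x(t))| dt` of the trajectory from `x`. -/
def flowLength (n : ℕ) (L : Finset E3) (x : E3) : ℝ :=
  ∫ t in {t : ℝ | 0 < t ∧ (t : EReal) < exitTime n L x}, ‖force L (trajectory n L x t)‖

end GravAlloc

end

/-! On a sphere of area `n` the Laplacian of `log |x - z|` is `-2π/n` away from `z`, so with `n`
points the force has constant divergence `2π` off `L`. By Liouville's theorem the preimage under the
time-`t` flow of a set `A` has area `exp (-2πt)` times that of `A`. Hence the integral over `x` of
`|F(Y_x(t))|`, counted as `0` after the exit time, is `exp (-2πt) ∫ |F|`, and Tonelli together with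
`∫_0^∞ exp (-2πt) dt = 1/(2π)` gives the identity. The integral of `|F|` is finite because `|F| ≤ ∑
1/|x - z|` and a spherical ball of radius `r` has area `O(r²)`.

The potential decreases along trajectories. Backward in time a trajectory therefore stays in a
superlevel set of `U`, which is compact and misses `L`; this is why the maximal domain is unbounded
below.

Calculus on the sphere is replaced by calculus in `E3`. The force extends to `coneField`, tangent to
every sphere about the origin and homogeneous of degree one, whose Euclidean divergence is the
constant `L.card / (2R²)`. The product `gapProd`, on the sphere a constant multiple of `exp (2U)`,
serves as Lyapunov function. Cutting the field off where `gapProd` is below `ε` gives a compactly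
supported `C¹` field, hence a global flow, which agrees with the true one while `gapProd > ε`. On
`{gapProd > ε}` backward orbits never meet the cutoff, so Liouville's theorem applies
(`volume_preimage_cutFlow`); homogeneity turns volume in a shell into area
(`area_preimage_cutFlow`), and monotone convergence as `ε → 0` gives `lintegral_speed`. -/

namespace GravAlloc

/-! ### Global flows of bounded Lipschitz fields. -/

section Flow

open Set
open scoped NNReal

variable {E : Type*} [NormedAddCommGroup E] [NormedSpace ℝ E]

/-- `Φ` is a global flow of the autonomous vector field `H`. -/
structure IsFlow (H : E → E) (Φ : ℝ → E → E) : Prop where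
  zero : ∀ x, Φ 0 x = x
  hasDerivAt : ∀ x t, HasDerivAt (fun s => Φ s x) (H (Φ t x)) t

theorem eqOn_of_hasDerivAt_of_lipschitz {H : E → E} {K : ℝ≥0} (hK : LipschitzWith K H)
    {γ γ' : ℝ → E} {I : Set ℝ} (hI : I.OrdConnected) (h0 : (0 : ℝ) ∈ I)
    (hγ : ∀ t ∈ I, HasDerivAt γ (H (γ t)) t) (hγ' : ∀ t ∈ I, HasDerivAt γ' (H (γ' t)) t)
    (heq : γ 0 = γ' 0) : EqOn γ γ' I := by
  intro t ht
  rcases le_total 0 t with h | h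
  · have hs : Icc 0 t ⊆ I := hI.out h0 ht
    exact ODE_solution_unique_of_mem_Icc_right (v := fun _ => H) (s := fun _ => univ) (K := K)
      (fun _ _ => hK.lipschitzOnWith)
      (fun s hs' => (hγ s (hs hs')).continuousAt.continuousWithinAt)
      (fun s hs' => (hγ s (hs (Ico_subset_Icc_self hs'))).hasDerivWithinAt) (fun _ _ => trivial)
      (fun s hs' => (hγ' s (hs hs')).continuousAt.continuousWithinAt)
      (fun s hs' => (hγ' s (hs (Ico_subset_Icc_self hs'))).hasDerivWithinAt) (fun _ _ => trivial)
      heq (right_mem_Icc.2 h)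
  · have hs : Icc t 0 ⊆ I := hI.out ht h0
    exact ODE_solution_unique_of_mem_Icc_left (v := fun _ => H) (s := fun _ => univ) (K := K)
      (fun _ _ => hK.lipschitzOnWith)
      (fun s hs' => (hγ s (hs hs')).continuousAt.continuousWithinAt)
      (fun s hs' => (hγ s (hs (Ioc_subset_Icc_self hs'))).hasDerivWithinAt) (fun _ _ => trivial)
      (fun s hs' => (hγ' s (hs hs')).continuousAt.continuousWithinAt)
      (fun s hs' => (hγ' s (hs (Ioc_subset_Icc_self hs'))).hasDerivWithinAt) (fun _ _ => trivial)
      heq (left_mem_Icc.2 h)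

theorem exists_hasDerivAt_Ioo_of_lipschitz [CompleteSpace E] {H : E → E} {K L : ℝ≥0}
    (hK : LipschitzWith K H) (hL : ∀ x, ‖H x‖ ≤ L) (x : E) (T : ℝ≥0) :
    ∃ γ : ℝ → E, γ 0 = x ∧ ∀ t ∈ Ioo (-T : ℝ) T, HasDerivAt γ (H (γ t)) t := by
  have h0 : (0 : ℝ) ∈ Icc (-T : ℝ) T := by simp
  -- In time `T` a curve of speed at most `L` moves by at most `L * T`, so a ball of this radius
  -- suffices for every `T`.
  have hPL : IsPicardLindelof (fun _ => H) (⟨0, h0⟩ : Icc (-T : ℝ) T) x (L * T) 0 L K :=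
    { lipschitzOnWith := fun _ _ => hK.lipschitzOnWith
      continuousOn := fun _ _ => continuousOn_const
      norm_le := fun _ _ y _ => hL y
      mul_max_le := by simp }
  obtain ⟨γ, h, h'⟩ := hPL.exists_eq_forall_mem_Icc_hasDerivWithinAt₀
  exact ⟨γ, h, fun t ht => (h' t (Ioo_subset_Icc_self ht)).hasDerivAt (Icc_mem_nhds ht.1 ht.2)⟩

theorem exists_hasDerivAt_of_lipschitz [CompleteSpace E] {H : E → E} {K L : ℝ≥0}
    (hK : LipschitzWith K H) (hL : ∀ x, ‖H x‖ ≤ L) (x : E) :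
    ∃ γ : ℝ → E, γ 0 = x ∧ ∀ t, HasDerivAt γ (H (γ t)) t := by
  choose γ h0 hγ using fun k : ℕ => exists_hasDerivAt_Ioo_of_lipschitz hK hL x (k : ℝ≥0)
  simp only [NNReal.coe_natCast] at hγ
  have hagree : ∀ j k : ℕ, 0 < j → j ≤ k → EqOn (γ j) (γ k) (Ioo (-j : ℝ) j) := by
    intro j k hj hjk
    have hjk' : (j : ℝ) ≤ k := by exact_mod_cast hjk
    refine eqOn_of_hasDerivAt_of_lipschitz hK ordConnected_Ioo ?_ (hγ j) ?_ ((h0 j).trans (h0 k).symm)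
    · simp [hj]
    · intro t ht
      exact hγ k t ⟨by linarith [ht.1], by linarith [ht.2]⟩
  -- The solutions on `(-k, k)` are glued by using at time `t` one with `|t| < k`. Near `t` the
  -- index is at most `N t + 1`, so the glued curve coincides there with the single solution `γ (N t
  -- + 1)`.
  let N : ℝ → ℕ := fun t => ⌊|t|⌋₊ + 1
  have hN : ∀ t, |t| < N t := fun t => by simpa [N] using Nat.lt_floor_add_one |t|
  refine ⟨fun t => γ (N t) t, h0 _, fun t => ?_⟩
  have hev : (fun s => γ (N s) s) =ᶠ[nhds t] γ (N t + 1) := by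
    have : ∀ᶠ s in nhds t, |s| < |t| + 1 :=
      continuous_abs.continuousAt.eventually_lt continuousAt_const (by simp)
    filter_upwards [this] with s hs
    refine hagree _ _ (Nat.succ_pos _) ?_ (abs_lt.1 (hN s))
    have : ⌊|s|⌋₊ ≤ ⌊|t| + 1⌋₊ := Nat.floor_le_floor hs.le
    rw [Nat.floor_add_one (abs_nonneg t)] at this
    simp only [N]; omega
  have ht : t ∈ Ioo (-((N t + 1 : ℕ) : ℝ)) ((N t + 1 : ℕ) : ℝ) := by
    refine abs_lt.1 ((hN t).trans ?_)
    push_cast; linarith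
  have := (hγ (N t + 1) t ht).congr_of_eventuallyEq hev
  rwa [← hev.eq_of_nhds] at this

theorem exists_isFlow [CompleteSpace E] {H : E → E} {K L : ℝ≥0}
    (hK : LipschitzWith K H) (hL : ∀ x, ‖H x‖ ≤ L) : ∃ Φ : ℝ → E → E, IsFlow H Φ := by
  choose γ h0 hγ using exists_hasDerivAt_of_lipschitz hK hL
  exact ⟨fun t x => γ x t, h0, hγ⟩

namespace IsFlow

variable {H : E → E} {Φ : ℝ → E → E} {K : ℝ≥0}

theorem continuous_time (hΦ : IsFlow H Φ) (x : E) : Continuous fun t => Φ t x :=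
  continuous_iff_continuousAt.2 fun t => (hΦ.hasDerivAt x t).continuousAt

theorem eqOn (hΦ : IsFlow H Φ) (hK : LipschitzWith K H) {γ : ℝ → E} {I : Set ℝ}
    (hI : I.OrdConnected) (h0 : (0 : ℝ) ∈ I) (hγ : ∀ t ∈ I, HasDerivAt γ (H (γ t)) t) :
    EqOn γ (fun t => Φ t (γ 0)) I :=
  eqOn_of_hasDerivAt_of_lipschitz hK hI h0 hγ (fun t _ => hΦ.hasDerivAt _ t) (hΦ.zero _).symm

theorem add (hΦ : IsFlow H Φ) (hK : LipschitzWith K H) (s t : ℝ) (x : E) :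
    Φ (s + t) x = Φ s (Φ t x) := by
  have := hΦ.eqOn hK (γ := fun s => Φ (s + t) x) ordConnected_univ (mem_univ _)
    (fun s _ => (hΦ.hasDerivAt x (s + t)).comp_add_const s t) (mem_univ s)
  simpa using this

theorem dist_le (hΦ : IsFlow H Φ) (hK : LipschitzWith K H) {t : ℝ} (ht : 0 ≤ t) (x y : E) :
    dist (Φ t x) (Φ t y) ≤ dist x y * Real.exp (K * t) := by
  have := dist_le_of_trajectories_ODE (v := fun _ => H) (a := 0) (b := t) (δ := dist x y)
    (fun _ => hK) (hΦ.continuous_time x).continuousOn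
    (fun s _ => (hΦ.hasDerivAt x s).hasDerivWithinAt) (hΦ.continuous_time y).continuousOn
    (fun s _ => (hΦ.hasDerivAt y s).hasDerivWithinAt) (by simp [hΦ.zero]) t (right_mem_Icc.2 ht)
  simpa using this

theorem neg (hΦ : IsFlow H Φ) : IsFlow (fun x => -H x) (fun t => Φ (-t)) where
  zero x := by simp [hΦ.zero]
  hasDerivAt x t := by
    simpa [Function.comp_def] using (hΦ.hasDerivAt x (-t)).scomp t (hasDerivAt_neg t)

theorem lipschitzWith (hΦ : IsFlow H Φ) (hK : LipschitzWith K H) (t : ℝ) :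
    LipschitzWith (Real.toNNReal (Real.exp (K * |t|))) (Φ t) := by
  refine LipschitzWith.of_dist_le_mul fun x y => ?_
  rw [Real.coe_toNNReal _ (Real.exp_nonneg _), mul_comm]
  rcases le_total 0 t with h | h
  · simpa [abs_of_nonneg h] using hΦ.dist_le hK h x y
  · have hK' : LipschitzWith K fun x => -H x := hK.neg
    simpa [abs_of_nonpos h] using hΦ.neg.dist_le hK' (neg_nonneg.2 h) x y

theorem continuous (hΦ : IsFlow H Φ) (hK : LipschitzWith K H) (t : ℝ) : Continuous (Φ t) :=
  (hΦ.lipschitzWith hK t).continuous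

theorem continuous_uncurry (hΦ : IsFlow H Φ) (hK : LipschitzWith K H) :
    Continuous fun p : ℝ × E => Φ p.1 p.2 := by
  refine continuous_iff_continuousAt.2 fun ⟨t, x⟩ => ?_
  have hC : ContinuousOn (Function.uncurry Φ) (Ioo (t - 1) (t + 1) ×ˢ univ) := by
    refine continuousOn_prod_of_continuousOn_lipschitzOnWith' _
      (Real.toNNReal (Real.exp (K * (|t| + 1)))) (fun s hs => ?_)
      fun x _ => (hΦ.continuous_time x).continuousOn
    refine ((hΦ.lipschitzWith hK s).weaken (Real.toNNReal_le_toNNReal ?_)).lipschitzOnWith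
    gcongr
    rw [abs_le]
    constructor <;> cases abs_cases t <;> linarith [hs.1, hs.2]
  exact hC.continuousAt (prod_mem_nhds (Ioo_mem_nhds (by linarith) (by linarith)) Filter.univ_mem)

theorem dist_self_le (hΦ : IsFlow H Φ) {L : ℝ≥0} (hL : ∀ x, ‖H x‖ ≤ L) (t : ℝ) (x : E) :
    ‖Φ t x - x‖ ≤ L * |t| := by
  have := convex_univ.norm_image_sub_le_of_norm_hasDerivWithin_le (f := fun t => Φ t x)
    (fun s _ => (hΦ.hasDerivAt x s).hasDerivWithinAt) (fun s _ => hL _) (mem_univ 0) (mem_univ t)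
  simpa [hΦ.zero] using this

end IsFlow

end Flow

/-! ### Liouville's theorem in Euclidean space. -/

section Liouville

open Set
open scoped NNReal

variable {ι : Type*} [Fintype ι]

/-- The divergence of a vector field on Euclidean space. -/
noncomputable def divergence [DecidableEq ι] (H : EuclideanSpace ℝ ι → EuclideanSpace ℝ ι)
    (x : EuclideanSpace ℝ ι) : ℝ :=
  ∑ i, fderiv ℝ H x (EuclideanSpace.single i 1) i

variable {H : EuclideanSpace ℝ ι → EuclideanSpace ℝ ι}
  {Φ : ℝ → EuclideanSpace ℝ ι → EuclideanSpace ℝ ι}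

/-- Bounded speed keeps far points far for bounded time. This gives compact support of `f ∘ Φ t` and
an integrable bound uniform in time. -/
theorem exists_norm_bound_of_flow_mem {L : ℝ≥0} (hΦ : IsFlow H Φ)
    (hL : ∀ x, ‖H x‖ ≤ L) {S : Set (EuclideanSpace ℝ ι)} (hS : Bornology.IsBounded S) (T : ℝ) :
    ∃ B : ℝ, ∀ t, |t| ≤ T → ∀ x, B < ‖x‖ → Φ t x ∉ S := by
  obtain ⟨ρ, hρ⟩ := hS.exists_norm_le
  refine ⟨ρ + L * T, fun t ht x hx hmem => ?_⟩
  have h1 := hρ _ hmem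
  have h2 := hΦ.dist_self_le hL t x
  have h3 : ‖x‖ ≤ ‖Φ t x‖ + ‖Φ t x - x‖ := by
    simpa using norm_sub_le (Φ t x) (Φ t x - x)
  have h4 : (L : ℝ) * |t| ≤ L * T := by gcongr
  linarith

variable [DecidableEq ι]

/-- Integration by parts, one coordinate at a time. The function is only Lipschitz because it will
be `f ∘ Φ s`; Rademacher's theorem supplies its derivative almost everywhere. -/
theorem integral_lineDeriv_field {g : EuclideanSpace ℝ ι → ℝ} {C : ℝ≥0} (hg : LipschitzWith C g)
    (hgc : HasCompactSupport g) (hH : ContDiff ℝ 1 H) (hHc : HasCompactSupport H) :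
    ∫ x, fderiv ℝ g x (H x) = -∫ x, divergence H x * g x := by
  have hcoord : ∀ i, ContDiff ℝ 1 fun x => H x i := fun i => by fun_prop
  have hcoordc : ∀ i, HasCompactSupport fun x => H x i := fun i =>
    hHc.comp_left (g := fun v : EuclideanSpace ℝ ι => v i) rfl
  have hint : ∀ i, Integrable fun x => lineDeriv ℝ g x (EuclideanSpace.single i 1) * H x i :=
    fun i => by
    have := ((hcoord i).continuous.integrable_of_hasCompactSupport (μ := volume) (hcoordc i)).bdd_mul
      (c := C * ‖(EuclideanSpace.single i 1 : EuclideanSpace ℝ ι)‖)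
      (aestronglyMeasurable_lineDeriv hg.continuous volume)
      (Filter.Eventually.of_forall fun x => norm_lineDeriv_le_of_lipschitz ℝ hg)
    exact this
  have h1 : ∫ x, fderiv ℝ g x (H x) =
      ∫ x, ∑ i, lineDeriv ℝ g x (EuclideanSpace.single i 1) * H x i := by
    refine integral_congr_ae ?_
    filter_upwards [hg.ae_differentiableAt] with x hx
    have hsum : H x = ∑ i, H x i • (EuclideanSpace.single i 1 : EuclideanSpace ℝ ι) := by
      ext j; simp [Finset.sum_apply, Pi.single_apply]
    conv_lhs => rw [hsum]
    simp only [map_sum, map_smul, smul_eq_mul, hx.lineDeriv_eq_fderiv, mul_comm]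
  have hderiv : ∀ i x, lineDeriv ℝ (fun x => H x i) x (-EuclideanSpace.single i 1) =
      -(fderiv ℝ H x (EuclideanSpace.single i 1) i) := by
    intro i x
    have hd : HasFDerivAt (fun x => H x i)
        ((EuclideanSpace.proj i : EuclideanSpace ℝ ι →L[ℝ] ℝ).comp (fderiv ℝ H x)) x :=
      (EuclideanSpace.proj i : EuclideanSpace ℝ ι →L[ℝ] ℝ).hasFDerivAt.comp x
        (hH.differentiable one_ne_zero x).hasFDerivAt
    rw [hd.differentiableAt.lineDeriv_eq_fderiv, hd.fderiv]
    simp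
  have hdc : ∀ i, Continuous fun x => fderiv ℝ H x (EuclideanSpace.single i 1) i := fun i => by
    have := hH.continuous_fderiv one_ne_zero
    fun_prop
  rw [h1, integral_finsetSum _ fun i _ => hint i, ← integral_neg]
  have h2 : ∀ i, ∫ x, lineDeriv ℝ g x (EuclideanSpace.single i 1) * H x i =
      ∫ x, -(fderiv ℝ H x (EuclideanSpace.single i 1) i) * g x := by
    intro i
    obtain ⟨D, hD⟩ := (hcoord i).lipschitzWith_of_hasCompactSupport (hcoordc i) one_ne_zero
    rw [hg.integral_lineDeriv_mul_eq hD (hcoordc i)]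
    simp_rw [hderiv]
  simp_rw [h2]
  rw [← integral_finsetSum]
  · simp only [divergence, Finset.sum_mul, neg_mul, Finset.sum_neg_distrib]
  · intro i _
    exact Continuous.integrable_of_hasCompactSupport ((hdc i).neg.mul hg.continuous) hgc.mul_left

/-- The integral solves `I' = -c I`: its derivative is the integral of the derivative of `f ∘ Φ s`
along `H`, and integration by parts moves this derivative onto `H`. The divergence matters only
where `f ∘ Φ s` is nonzero, that is, on backward orbits of the support. -/
theorem IsFlow.integral_comp {K : ℝ≥0} (hΦ : IsFlow H Φ) (hK : LipschitzWith K H)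
    (hH : ContDiff ℝ 1 H) (hHc : HasCompactSupport H)
    {f : EuclideanSpace ℝ ι → ℝ} (hf : ContDiff ℝ 1 f) (hfc : HasCompactSupport f) {c : ℝ}
    (hdiv : ∀ t, 0 ≤ t → ∀ x, f (Φ t x) ≠ 0 → divergence H x = c) {t : ℝ} (ht : 0 ≤ t) :
    ∫ x, f (Φ t x) = Real.exp (-c * t) * ∫ x, f x := by
  obtain ⟨L', hL'⟩ := hHc.exists_bound_of_continuous hH.continuous
  obtain ⟨L, hL⟩ : ∃ L : ℝ≥0, ∀ x, ‖H x‖ ≤ L :=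
    ⟨L'.toNNReal, fun x => (hL' x).trans (Real.le_coe_toNNReal _)⟩
  obtain ⟨C, hC⟩ := hf.lipschitzWith_of_hasCompactSupport hfc one_ne_zero
  have hderiv : ∀ s x, HasDerivAt (fun s => f (Φ s x)) (fderiv ℝ f (Φ s x) (H (Φ s x))) s :=
    fun s x => (hf.differentiable one_ne_zero _).hasFDerivAt.comp_hasDerivAt s (hΦ.hasDerivAt x s)
  have hcompact : ∀ s, HasCompactSupport fun x => f (Φ s x) := fun s => by
    obtain ⟨B, hB⟩ := exists_norm_bound_of_flow_mem hΦ hL hfc.isCompact.isBounded |s|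
    refine HasCompactSupport.intro (isCompact_closedBall 0 B) fun x hx => ?_
    exact image_eq_zero_of_notMem_tsupport (hB s le_rfl x (by simpa using hx))
  have hcf : Continuous fun y => fderiv ℝ f y (H y) := by
    have := hf.continuous_fderiv one_ne_zero
    have := hH.continuous
    fun_prop
  have hI : ∀ s, HasDerivAt (fun s => ∫ x, f (Φ s x)) (∫ x, fderiv ℝ f (Φ s x) (H (Φ s x))) s := by
    intro s
    obtain ⟨B, hB⟩ := exists_norm_bound_of_flow_mem hΦ hL hfc.isCompact.isBounded (|s| + 1)
    refine (hasDerivAt_integral_of_dominated_loc_of_deriv_le (μ := volume) (𝕜 := ℝ) (E := ℝ)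
      (F := fun s x => f (Φ s x)) (F' := fun s x => fderiv ℝ f (Φ s x) (H (Φ s x)))
      (s := Metric.ball s 1)
      (bound := (Metric.closedBall (0 : EuclideanSpace ℝ ι) B).indicator fun _ => (C : ℝ) * L)
      (Metric.ball_mem_nhds s one_pos) ?_ ?_ ?_ ?_ ?_ ?_).2
    · exact Filter.Eventually.of_forall fun r =>
        (hf.continuous.comp (hΦ.continuous hK r)).aestronglyMeasurable
    · exact (hf.continuous.comp (hΦ.continuous hK s)).integrable_of_hasCompactSupport (hcompact s)
    · exact (hcf.comp (hΦ.continuous hK s)).aestronglyMeasurable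
    · refine Filter.Eventually.of_forall fun x r hr => ?_
      by_cases hx : x ∈ Metric.closedBall (0 : EuclideanSpace ℝ ι) B
      · rw [indicator_of_mem hx]
        exact (ContinuousLinearMap.le_opNorm _ _).trans (mul_le_mul (norm_fderiv_le_of_lipschitz ℝ hC)
          (hL _) (norm_nonneg _) C.2)
      · rw [indicator_of_notMem hx]
        have hr' : |r| ≤ |s| + 1 := by
          have : |r - s| < 1 := by simpa [Real.dist_eq] using hr
          have := abs_sub_abs_le_abs_sub r s
          linarith
        have := hB r hr' x (by simpa using hx)
        have h0 : fderiv ℝ f (Φ r x) = 0 :=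
          image_eq_zero_of_notMem_tsupport fun h => this (tsupport_fderiv_subset ℝ h)
        simp [h0]
    · exact (integrableOn_const (by simp [measure_closedBall_lt_top.ne])).integrable_indicator
        Metric.isClosed_closedBall.measurableSet
    · exact Filter.Eventually.of_forall fun x r _ => hderiv r x
  have hI' : ∀ s, 0 ≤ s → ∫ x, fderiv ℝ f (Φ s x) (H (Φ s x)) = -c * ∫ x, f (Φ s x) := by
    intro s hs
    have hg := hC.comp (hΦ.lipschitzWith hK s)
    -- Both integrands are the derivative at `r = 0` of `f (Φ (s + r) x)`, read once as motion after
    -- `Φ s` and once as motion before it. No differentiability of the flow in its initial point is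
    -- needed beyond Rademacher.
    have h1 : ∫ x, fderiv ℝ f (Φ s x) (H (Φ s x)) = ∫ x, fderiv ℝ (f ∘ Φ s) x (H x) := by
      refine integral_congr_ae ?_
      filter_upwards [hg.ae_differentiableAt] with x hx
      have e1 : HasDerivAt (fun r => f (Φ (s + r) x)) (fderiv ℝ f (Φ s x) (H (Φ s x))) 0 := by
        have := hderiv (s + 0) x
        simpa using this.comp_const_add s 0
      have e2 : HasDerivAt (fun r => f (Φ (s + r) x)) (fderiv ℝ (f ∘ Φ s) x (H x)) 0 := by
        have hx' : HasFDerivAt (f ∘ Φ s) (fderiv ℝ (f ∘ Φ s) x) (Φ 0 x) := by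
          rw [hΦ.zero]; exact hx.hasFDerivAt
        have := hx'.comp_hasDerivAt 0 (hΦ.hasDerivAt x 0)
        rw [hΦ.zero] at this
        refine this.congr_of_eventuallyEq (Filter.Eventually.of_forall fun r => ?_)
        simp [hΦ.add hK]
      exact e1.unique e2
    rw [h1, integral_lineDeriv_field hg (hcompact s) hH hHc, ← integral_const_mul, ← integral_neg]
    refine integral_congr_ae (Filter.Eventually.of_forall fun x => ?_)
    by_cases hx : f (Φ s x) = 0
    · simp [hx]
    · simp [hdiv s hs x hx]
  have hconst := constant_of_has_deriv_right_zero
    (f := fun s => Real.exp (c * s) * ∫ x, f (Φ s x)) (a := 0) (b := t)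
    (fun s _ => ((by fun_prop : ContinuousAt (fun s : ℝ => Real.exp (c * s)) s).mul
      (hI s).continuousAt).continuousWithinAt)
    (fun s hs => by
      have he : HasDerivAt (fun s : ℝ => Real.exp (c * s)) (Real.exp (c * s) * c) s := by
        simpa using ((hasDerivAt_id s).const_mul c).exp
      have := he.fun_mul (hI s)
      rw [hI' s hs.1, show Real.exp (c * s) * c * (∫ x, f (Φ s x)) +
        Real.exp (c * s) * (-c * ∫ x, f (Φ s x)) = 0 by ring] at this
      exact this.hasDerivWithinAt) t (right_mem_Icc.2 ht)
  simp only [mul_zero, Real.exp_zero, one_mul, hΦ.zero] at hconst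
  rw [← hconst, ← mul_assoc, ← Real.exp_add]
  simp

theorem IsFlow.volume_preimage_of_isOpen {K : ℝ≥0} (hΦ : IsFlow H Φ) (hK : LipschitzWith K H)
    (hH : ContDiff ℝ 1 H) (hHc : HasCompactSupport H) {V : Set (EuclideanSpace ℝ ι)} (hV : IsOpen V)
    (hVb : Bornology.IsBounded V) {c : ℝ}
    (hdiv : ∀ t, 0 ≤ t → ∀ x, Φ t x ∈ V → divergence H x = c) {t : ℝ} (ht : 0 ≤ t) :
    volume (Φ t ⁻¹' V) = ENNReal.ofReal (Real.exp (-c * t)) * volume V := by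
  obtain ⟨f, hfs, hf, hfr⟩ := hV.exists_contDiff_support_eq (n := 1)
  have hf01 : ∀ x, 0 ≤ f x ∧ f x ≤ 1 := fun x => hfr (mem_range_self x)
  have hfV : ∀ x, f x ≠ 0 ↔ x ∈ V := fun x => by rw [← hfs]; rfl
  -- These `C¹` functions vanish off `V` and tend to its indicator, since `0 < f ≤ 1` on `V`.
  let F : ℕ → EuclideanSpace ℝ ι → ℝ := fun k x => 1 - (1 - f x) ^ k
  have hFV : ∀ k x, F k x ≠ 0 → x ∈ V := fun k x h => by
    rw [← hfV]; intro h0; simp [F, h0] at h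
  have hFsmooth : ∀ k, ContDiff ℝ 1 (F k) := fun k => by
    have : ContDiff ℝ 1 f := hf
    fun_prop
  have hFc : ∀ k, HasCompactSupport (F k) := fun k =>
    HasCompactSupport.intro hVb.isCompact_closure fun x hx => by
      by_contra h; exact hx (subset_closure (hFV k x h))
  have hFle : ∀ k x, ‖F k x‖ ≤ V.indicator (fun _ => (1 : ℝ)) x := fun k x => by
    have h1 : (1 - f x) ^ k ≤ 1 := pow_le_one₀ (by linarith [(hf01 x).2]) (by linarith [(hf01 x).1])
    have h2 : 0 ≤ (1 - f x) ^ k := pow_nonneg (by linarith [(hf01 x).2]) _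
    by_cases hx : x ∈ V
    · rw [indicator_of_mem hx, Real.norm_eq_abs, abs_le]
      constructor <;> simp only [F] <;> linarith
    · have : F k x = 0 := by by_contra h; exact hx (hFV k x h)
      simp [hx, this]
  have hFlim : ∀ x, Filter.Tendsto (fun k => F k x) Filter.atTop
      (nhds (V.indicator (fun _ => (1 : ℝ)) x)) := fun x => by
    by_cases hx : x ∈ V
    · rw [indicator_of_mem hx]
      have hpos : 0 < f x := lt_of_le_of_ne (hf01 x).1 (Ne.symm ((hfV x).2 hx))
      have := tendsto_pow_atTop_nhds_zero_of_lt_one (r := 1 - f x) (by linarith [(hf01 x).2])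
        (by linarith)
      simpa using this.const_sub 1
    · have : ∀ k, F k x = 0 := fun k => by by_contra h; exact hx (hFV k x h)
      simp [hx, this]
  have hpb : Bornology.IsBounded (Φ t ⁻¹' V) := by
    obtain ⟨L', hL'⟩ := hHc.exists_bound_of_continuous hH.continuous
    obtain ⟨B, hB⟩ := exists_norm_bound_of_flow_mem (L := L'.toNNReal) hΦ
      (fun x => (hL' x).trans (Real.le_coe_toNNReal _)) hVb |t|
    exact isBounded_iff_forall_norm_le.2 ⟨B, fun x hx => not_lt.1 fun h => hB t le_rfl x h hx⟩
  have hm : MeasurableSet (Φ t ⁻¹' V) := (hΦ.continuous hK t).measurable hV.measurableSet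
  have lim1 : Filter.Tendsto (fun k => ∫ x, F k x) Filter.atTop
      (nhds (∫ x, V.indicator (fun _ => (1 : ℝ)) x)) :=
    tendsto_integral_of_dominated_convergence (V.indicator fun _ => (1 : ℝ))
      (fun k => (hFsmooth k).continuous.aestronglyMeasurable)
      ((integrableOn_const (by simpa using hVb.measure_lt_top.ne)).integrable_indicator
        hV.measurableSet)
      (fun k => Filter.Eventually.of_forall (hFle k)) (Filter.Eventually.of_forall hFlim)
  have lim2 : Filter.Tendsto (fun k => ∫ x, F k (Φ t x)) Filter.atTop
      (nhds (∫ x, (Φ t ⁻¹' V).indicator (fun _ => (1 : ℝ)) x)) :=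
    tendsto_integral_of_dominated_convergence ((Φ t ⁻¹' V).indicator fun _ => (1 : ℝ))
      (fun k => ((hFsmooth k).continuous.comp (hΦ.continuous hK t)).aestronglyMeasurable)
      ((integrableOn_const (by simpa using hpb.measure_lt_top.ne)).integrable_indicator hm)
      (fun k => Filter.Eventually.of_forall fun x => hFle k (Φ t x))
      (Filter.Eventually.of_forall fun x => hFlim (Φ t x))
  have heq : ∀ k, ∫ x, F k (Φ t x) = Real.exp (-c * t) * ∫ x, F k x := fun k =>
    hΦ.integral_comp hK hH hHc (hFsmooth k) (hFc k)
      (fun s hs x hx => hdiv s hs x (hFV k _ hx)) ht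
  simp_rw [heq] at lim2
  have := tendsto_nhds_unique lim2 (lim1.const_mul (Real.exp (-c * t)))
  rw [integral_indicator hm, integral_indicator hV.measurableSet] at this
  simp only [integral_const, smul_eq_mul, mul_one, measureReal_restrict_apply_univ] at this
  rw [← ENNReal.ofReal_toReal hpb.measure_lt_top.ne, ← ENNReal.ofReal_toReal hVb.measure_lt_top.ne,
    ← ENNReal.ofReal_mul (Real.exp_nonneg _)]
  exact congrArg _ this

/-- **Liouville's theorem**: a flow whose field has constant divergence `c` on the backward orbits
of an open set scales the volume of the subsets of this set by `exp (-c * t)`. -/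
theorem IsFlow.volume_preimage {K : ℝ≥0} (hΦ : IsFlow H Φ) (hK : LipschitzWith K H)
    (hH : ContDiff ℝ 1 H) (hHc : HasCompactSupport H) {O : Set (EuclideanSpace ℝ ι)} (hO : IsOpen O)
    (hOb : Bornology.IsBounded O) {c : ℝ}
    (hdiv : ∀ t, 0 ≤ t → ∀ x, Φ t x ∈ O → divergence H x = c) {t : ℝ} (ht : 0 ≤ t)
    {A : Set (EuclideanSpace ℝ ι)} (hA : MeasurableSet A) (hAO : A ⊆ O) :
    volume (Φ t ⁻¹' A) = ENNReal.ofReal (Real.exp (-c * t)) * volume A := by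
  have hm : Measurable (Φ t) := (hΦ.continuous hK t).measurable
  -- Open sets form a pi-system generating the Borel sets; restriction to the bounded set `O` makes
  -- both measures finite.
  have hopen : ∀ V, IsOpen V → ((volume.map (Φ t)).restrict O) V =
      ((ENNReal.ofReal (Real.exp (-c * t)) • volume).restrict O) V := fun V hV => by
    rw [Measure.restrict_apply hV.measurableSet, Measure.restrict_apply hV.measurableSet,
      Measure.map_apply hm (hV.inter hO).measurableSet, Measure.smul_apply, smul_eq_mul]
    exact hΦ.volume_preimage_of_isOpen hK hH hHc (hV.inter hO) (hOb.subset inter_subset_right)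
      (fun s hs x hx => hdiv s hs x hx.2) ht
  have : IsFiniteMeasure ((volume.map (Φ t)).restrict O) := ⟨by
    rw [hopen univ isOpen_univ]
    simpa using ENNReal.mul_lt_top ENNReal.ofReal_lt_top hOb.measure_lt_top⟩
  have heq := ext_of_generate_finite {V | IsOpen V} BorelSpace.measurable_eq isPiSystem_isOpen
    hopen (hopen univ isOpen_univ)
  have := congrArg (fun μ => μ A) heq
  simpa [Measure.restrict_apply hA, inter_eq_left.2 hAO, Measure.map_apply hm hA] using this

end Liouville

/-! ### The homogeneous extension of the force, its cutoff, its divergence and its Lyapunov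
function. -/

section Field

open Set

/-- `|x|` times the gap in the Cauchy-Schwarz inequality between `x / |x|` and `z`, if `|z| = R`. -/
noncomputable def gap (R : ℝ) (z x : E3) : ℝ := R * ‖x‖ - ⟪x, z⟫

/-- The product of the gaps, as a function of the direction of `x`. -/
noncomputable def gapProd (R : ℝ) (L : Finset E3) (x : E3) : ℝ := ∏ z ∈ L, gap R z x / ‖x‖

/-- The extension of the force of a single point that is homogeneous of degree one. -/
noncomputable def pointField (R : ℝ) (z x : E3) : E3 :=
  (2 * R ^ 2 * gap R z x)⁻¹ • (‖x‖ ^ 2 • z - ⟪x, z⟫ • x)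

/-- The extension of the force that is homogeneous of degree one. -/
noncomputable def coneField (R : ℝ) (L : Finset E3) (x : E3) : E3 := ∑ z ∈ L, pointField R z x

/-- A smooth step from `0` on `(-∞, 1/2]` to `1` on `[1, ∞)`. -/
noncomputable def step (p : ℝ) : ℝ := Real.smoothTransition (2 * p - 1)

/-- A smooth bump around `R ^ 2`. -/
noncomputable def shellBump (R : ℝ) (hR : 0 < R) : ContDiffBump (R ^ 2) :=
  ⟨R ^ 2 / 4, R ^ 2 / 2, by positivity, by linarith [pow_pos hR 2]⟩

/-- The factor that cuts `coneField` off near its singularities and far from the sphere. -/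
noncomputable def cutoff (R : ℝ) (hR : 0 < R) (L : Finset E3) (ε : ℝ) (x : E3) : ℝ :=
  shellBump R hR (‖x‖ ^ 2) * step (gapProd R L x / ε)

/-- The field `coneField`, cut off near its singularities and far from the sphere. -/
noncomputable def cutField (R : ℝ) (hR : 0 < R) (L : Finset E3) (ε : ℝ) (x : E3) : E3 :=
  cutoff R hR L ε x • coneField R L x

variable {R : ℝ} {z x : E3} {L : Finset E3} {ε : ℝ}

theorem gap_nonneg (hz : ‖z‖ = R) (x : E3) : 0 ≤ gap R z x := by
  have := real_inner_le_norm x z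
  rw [hz] at this
  unfold gap; linarith [mul_comm R ‖x‖]

theorem gap_eq_zero_iff (hR : 0 < R) (hz : ‖z‖ = R) (hx : ‖x‖ = R) : gap R z x = 0 ↔ x = z := by
  have h := inner_eq_norm_mul_iff_real (x := x) (y := z)
  rw [hz, hx] at h
  rw [gap, hx, sub_eq_zero, eq_comm, h]
  exact (smul_right_injective E3 hR.ne').eq_iff

theorem gapProd_nonneg (hL : ∀ z ∈ L, ‖z‖ = R) (x : E3) : 0 ≤ gapProd R L x :=
  Finset.prod_nonneg fun z hz => div_nonneg (gap_nonneg (hL z hz) x) (norm_nonneg x)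

theorem gapProd_eq_zero_iff (hR : 0 < R) (hL : ∀ z ∈ L, ‖z‖ = R) (hx : ‖x‖ = R) :
    gapProd R L x = 0 ↔ x ∈ L := by
  rw [gapProd, Finset.prod_eq_zero_iff]
  constructor
  · rintro ⟨z, hz, h⟩
    rw [div_eq_zero_iff, or_iff_left (by rw [hx]; exact hR.ne'), gap_eq_zero_iff hR (hL z hz) hx] at h
    exact h ▸ hz
  · intro h
    exact ⟨x, h, by rw [(gap_eq_zero_iff hR hx hx).2 rfl, zero_div]⟩

theorem gapProd_pos (hR : 0 < R) (hL : ∀ z ∈ L, ‖z‖ = R) (hx : ‖x‖ = R) (hxL : x ∉ L) :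
    0 < gapProd R L x :=
  lt_of_le_of_ne (gapProd_nonneg hL x) fun h => hxL ((gapProd_eq_zero_iff hR hL hx).1 h.symm)

theorem gap_ne_zero_of_gapProd (h : gapProd R L x ≠ 0) (hz : z ∈ L) : gap R z x ≠ 0 := by
  intro h0
  exact h (Finset.prod_eq_zero hz (by rw [h0, zero_div]))

theorem contDiffAt_gap (hx : x ≠ 0) : ContDiffAt ℝ 1 (gap R z) x := by
  have : ContDiffAt ℝ 1 (fun x : E3 => ‖x‖) x := contDiffAt_norm ℝ hx
  exact (contDiffAt_const.mul this).sub (contDiffAt_id.inner ℝ contDiffAt_const)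

theorem contDiffAt_gapProd (hx : x ≠ 0) : ContDiffAt ℝ 1 (gapProd R L) x := by
  have h1 : ContDiffAt ℝ 1 (fun x : E3 => ‖x‖) x := contDiffAt_norm ℝ hx
  unfold gapProd
  exact contDiffAt_prod fun z _ => (contDiffAt_gap hx).div h1 (norm_ne_zero_iff.2 hx)

theorem contDiffAt_pointField (hR : 0 < R) (hx : x ≠ 0) (h : gap R z x ≠ 0) :
    ContDiffAt ℝ 1 (pointField R z) x := by
  have h1 : ContDiffAt ℝ 1 (gap R z) x := contDiffAt_gap hx
  have h2 : ContDiffAt ℝ 1 (fun x => (2 * R ^ 2 * gap R z x)⁻¹) x :=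
    (contDiffAt_const.mul h1).inv (by positivity)
  have h3 : ContDiffAt ℝ 1 (fun x : E3 => ‖x‖ ^ 2) x := (contDiff_norm_sq ℝ).contDiffAt
  exact h2.smul ((h3.smul contDiffAt_const).sub
    ((contDiffAt_id.inner ℝ contDiffAt_const).smul contDiffAt_id))

theorem contDiffAt_coneField (hR : 0 < R) (hx : x ≠ 0) (h : gapProd R L x ≠ 0) :
    ContDiffAt ℝ 1 (coneField R L) x := by
  unfold coneField
  exact ContDiffAt.sum fun z hz => contDiffAt_pointField hR hx (gap_ne_zero_of_gapProd h hz)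

theorem step_nonneg (p : ℝ) : 0 ≤ step p := Real.smoothTransition.nonneg _

theorem step_eq_zero {p : ℝ} (hp : p ≤ 1 / 2) : step p = 0 :=
  Real.smoothTransition.zero_of_nonpos (by linarith)

theorem step_eq_one {p : ℝ} (hp : 1 ≤ p) : step p = 1 :=
  Real.smoothTransition.one_of_one_le (by linarith)

theorem contDiff_step : ContDiff ℝ 1 step :=
  Real.smoothTransition.contDiff.comp (by fun_prop)

theorem cutoff_nonneg (hR : 0 < R) (x : E3) : 0 ≤ cutoff R hR L ε x :=
  mul_nonneg (ContDiffBump.nonneg _) (step_nonneg _)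

theorem cutoff_eq_zero_of_gapProd_le (hR : 0 < R) (hε : 0 < ε) (h : gapProd R L x ≤ ε / 2) :
    cutoff R hR L ε x = 0 := by
  rw [cutoff, step_eq_zero, mul_zero]
  rw [div_le_iff₀ hε]; linarith

/-- The open shell around the sphere where the radial cutoff is `1`. -/
def shell (R : ℝ) : Set E3 := {x | 3 / 4 * R ^ 2 < ‖x‖ ^ 2 ∧ ‖x‖ ^ 2 < 5 / 4 * R ^ 2}

theorem isOpen_shell (R : ℝ) : IsOpen (shell R) :=
  (isOpen_lt (f := fun _ : E3 => 3 / 4 * R ^ 2) (g := fun x => ‖x‖ ^ 2) (by fun_prop)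
    (by fun_prop)).inter (isOpen_lt (f := fun x : E3 => ‖x‖ ^ 2) (by fun_prop) (by fun_prop))

theorem ne_zero_of_mem_shell (hx : x ∈ shell R) : x ≠ 0 := by
  rintro rfl
  have := hx.1
  simp only [norm_zero] at this
  nlinarith [sq_nonneg R]

theorem mem_shell_of_norm_eq (hR : 0 < R) (hx : ‖x‖ = R) : x ∈ shell R := by
  have := pow_pos hR 2
  constructor <;> rw [hx] <;> linarith

theorem isBounded_shell (hR : 0 < R) : Bornology.IsBounded (shell R) :=
  isBounded_iff_forall_norm_le.2 ⟨2 * R, fun x hx => by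
    refine abs_le_of_sq_le_sq' ?_ (by positivity) |>.2
    nlinarith [hx.2, sq_nonneg R]⟩

theorem cutoff_eq_one (hR : 0 < R) (hε : 0 < ε) (hx : x ∈ shell R) (h : ε ≤ gapProd R L x) :
    cutoff R hR L ε x = 1 := by
  rw [cutoff, step_eq_one ((one_le_div hε).2 h), mul_one]
  refine ContDiffBump.one_of_mem_closedBall _ ?_
  rw [Metric.mem_closedBall, Real.dist_eq, abs_le]
  change -(R ^ 2 / 4) ≤ _ ∧ _ ≤ R ^ 2 / 4
  constructor <;> linarith [hx.1, hx.2]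

theorem cutField_eq (hR : 0 < R) (hε : 0 < ε) (hx : x ∈ shell R) (h : ε ≤ gapProd R L x) :
    cutField R hR L ε x = coneField R L x := by
  rw [cutField, cutoff_eq_one hR hε hx h, one_smul]

theorem shellBump_eq_zero (hR : 0 < R) (hx : ‖x‖ ^ 2 ∉ Ioo (R ^ 2 / 2) (2 * R ^ 2)) :
    shellBump R hR (‖x‖ ^ 2) = 0 := by
  refine ContDiffBump.zero_of_le_dist _ ?_
  rw [Real.dist_eq, le_abs]
  change R ^ 2 / 2 ≤ _ ∨ R ^ 2 / 2 ≤ _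
  by_contra! h
  exact hx ⟨by linarith [h.2], by linarith [h.1, sq_nonneg R]⟩

theorem hasCompactSupport_cutField (hR : 0 < R) : HasCompactSupport (cutField R hR L ε) := by
  refine HasCompactSupport.intro (isCompact_closedBall 0 (2 * R)) fun x hx => ?_
  rw [cutField, cutoff, shellBump_eq_zero hR, zero_mul, zero_smul]
  intro h
  have : 2 * R < ‖x‖ := by simpa using hx
  nlinarith [h.2]

/-- The possible singularities are the origin, where the radial bump vanishes nearby, and the zeros
of `gapProd`, near which the step vanishes because `gapProd < ε / 2`. -/
theorem contDiff_cutField (hR : 0 < R) (hε : 0 < ε) :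
    ContDiff ℝ 1 (cutField R hR L ε) := by
  refine contDiff_iff_contDiffAt.2 fun x => ?_
  by_cases hx : x = 0
  · have : cutField R hR L ε =ᶠ[nhds x] fun _ => 0 := by
      have h : ∀ᶠ y : E3 in nhds x, ‖y‖ ^ 2 < R ^ 2 / 2 := by
        refine (by fun_prop : ContinuousAt (fun y : E3 => ‖y‖ ^ 2) x).eventually_lt
          continuousAt_const ?_
        rw [hx, norm_zero]; nlinarith [pow_pos hR 2]
      filter_upwards [h] with y hy
      rw [cutField, cutoff, shellBump_eq_zero hR fun h' => absurd h'.1 (not_lt.2 hy.le), zero_mul,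
        zero_smul]
    exact contDiffAt_const.congr_of_eventuallyEq this
  have hP : ContDiffAt ℝ 1 (gapProd R L) x := contDiffAt_gapProd hx
  by_cases h : gapProd R L x = 0
  · have : cutField R hR L ε =ᶠ[nhds x] fun _ => 0 := by
      have h' : ∀ᶠ y in nhds x, gapProd R L y < ε / 2 :=
        hP.continuousAt.eventually_lt continuousAt_const (by rw [h]; positivity)
      filter_upwards [h'] with y hy
      rw [cutField, cutoff_eq_zero_of_gapProd_le hR hε hy.le, zero_smul]
    exact contDiffAt_const.congr_of_eventuallyEq this
  · have h1 : ContDiffAt ℝ 1 (fun y : E3 => shellBump R hR (‖y‖ ^ 2)) x :=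
      ((shellBump R hR).contDiff.comp (contDiff_norm_sq ℝ)).contDiffAt
    have h2 : ContDiffAt ℝ 1 (fun y => step (gapProd R L y / ε)) x :=
      contDiff_step.contDiffAt.comp x (hP.div_const ε)
    exact (h1.mul h2).smul (contDiffAt_coneField hR hx h)

theorem inner_pointField (x z : E3) : ⟪x, pointField R z x⟫ = 0 := by
  simp only [pointField, inner_smul_right, inner_sub_right, real_inner_self_eq_norm_sq]
  ring

theorem inner_coneField (x : E3) : ⟪x, coneField R L x⟫ = 0 := by
  simp [coneField, inner_sum, inner_pointField]

theorem inner_cutField (hR : 0 < R) (x : E3) : ⟪x, cutField R hR L ε x⟫ = 0 := by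
  simp [cutField, inner_smul_right, inner_coneField]

section Homogeneous

variable {s : ℝ}

theorem gap_smul (hs : 0 < s) : gap R z (s • x) = s * gap R z x := by
  rw [gap, gap, norm_smul, real_inner_smul_left, Real.norm_eq_abs, abs_of_pos hs]; ring

theorem gapProd_smul (hs : 0 < s) : gapProd R L (s • x) = gapProd R L x := by
  refine Finset.prod_congr rfl fun z _ => ?_
  rw [gap_smul hs, norm_smul, Real.norm_eq_abs, abs_of_pos hs, mul_div_mul_left _ _ hs.ne']

theorem pointField_smul (hs : 0 < s) : pointField R z (s • x) = s • pointField R z x := by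
  rw [pointField, pointField, gap_smul hs, norm_smul, real_inner_smul_left, Real.norm_eq_abs,
    abs_of_pos hs]
  have : (s * ‖x‖) ^ 2 • z - (s * ⟪x, z⟫) • s • x = s ^ 2 • (‖x‖ ^ 2 • z - ⟪x, z⟫ • x) := by
    module
  rw [this, smul_smul, smul_smul]
  congr 1
  rw [show 2 * R ^ 2 * (s * gap R z x) = s * (2 * R ^ 2 * gap R z x) by ring, mul_inv]
  field_simp

theorem coneField_smul (hs : 0 < s) : coneField R L (s • x) = s • coneField R L x := by
  simp only [coneField, pointField_smul hs, Finset.smul_sum]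

theorem cutField_smul (hR : 0 < R) (hs : 0 < s) (hx : x ∈ shell R) (hsx : s • x ∈ shell R) :
    cutField R hR L ε (s • x) = s • cutField R hR L ε x := by
  have h : ∀ y ∈ shell R, shellBump R hR (‖y‖ ^ 2) = 1 := fun y hy => by
    refine ContDiffBump.one_of_mem_closedBall _ ?_
    rw [Metric.mem_closedBall, Real.dist_eq, abs_le]
    change -(R ^ 2 / 4) ≤ _ ∧ _ ≤ R ^ 2 / 4
    constructor <;> linarith [hy.1, hy.2]
  rw [cutField, cutField, cutoff, cutoff, h _ hx, h _ hsx, gapProd_smul hs, coneField_smul hs,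
    smul_comm]

end Homogeneous

theorem hasFDerivAt_norm_of_ne_zero (hx : x ≠ 0) :
    HasFDerivAt (fun y : E3 => ‖y‖) (‖x‖⁻¹ • innerSL ℝ x) x := by
  have h := ((hasStrictFDerivAt_norm_sq (F := E3) x).hasFDerivAt).sqrt
    (by simpa using hx)
  simp only [Real.sqrt_sq (norm_nonneg _)] at h
  refine h.congr_fderiv ?_
  ext v
  simp only [smul_apply, smul_eq_mul, nsmul_eq_mul, Nat.cast_ofNat]
  field_simp

theorem divergence_pointField (hR : 0 < R) (hz : ‖z‖ = R) (hx : x ≠ 0) (h : gap R z x ≠ 0) :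
    divergence (pointField R z) x = 1 / (2 * R ^ 2) := by
  have hgap : HasFDerivAt (gap R z) (R • ‖x‖⁻¹ • innerSL ℝ x - innerSL ℝ z) x := by
    have h2 : HasFDerivAt (fun y : E3 => ⟪y, z⟫) (innerSL ℝ z) x := by
      have := (innerSL ℝ z).hasFDerivAt (x := x)
      exact this.congr_of_eventuallyEq (Filter.Eventually.of_forall fun y => real_inner_comm _ _)
    exact ((hasFDerivAt_norm_of_ne_zero hx).const_mul R).sub h2
  have hinner : HasFDerivAt (fun y : E3 => ⟪y, z⟫) (innerSL ℝ z) x := by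
    have := (innerSL ℝ z).hasFDerivAt (x := x)
    exact this.congr_of_eventuallyEq (Filter.Eventually.of_forall fun y => real_inner_comm _ _)
  have hnum := ((hasStrictFDerivAt_norm_sq (F := E3) x).hasFDerivAt.smul_const z).sub
    (hinner.smul (hasFDerivAt_id x))
  have hne : 2 * R ^ 2 * gap R z x ≠ 0 := by positivity
  have hden := (hasDerivAt_inv hne).comp_hasFDerivAt x (hgap.const_mul (2 * R ^ 2))
  have hall : HasFDerivAt (pointField R z) _ x := hden.smul hnum
  have hx3 := EuclideanSpace.real_norm_sq_eq x
  have hz3 := EuclideanSpace.real_norm_sq_eq z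
  have hi : ⟪x, z⟫ = x 0 * z 0 + x 1 * z 1 + x 2 * z 2 := by
    simp [PiLp.inner_apply, Fin.sum_univ_three, mul_comm]
  have hn : ‖x‖ ≠ 0 := norm_ne_zero_iff.2 hx
  rw [divergence, hall.fderiv]
  simp [Fin.sum_univ_three, real_inner_comm, EuclideanSpace.inner_single_right]
  rw [Fin.sum_univ_three] at hx3 hz3
  rw [hz] at hz3
  rw [real_inner_comm] at hi
  have hg : gap R z x = R * ‖x‖ - ⟪z, x⟫ := by rw [gap, real_inner_comm]
  generalize ⟪z, x⟫ = i at *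
  generalize gap R z x = g at *
  generalize ‖x‖ = r at *
  generalize x 0 = x0 at *
  generalize x 1 = x1 at *
  generalize x 2 = x2 at *
  generalize z 0 = z0 at *
  generalize z 1 = z1 at *
  generalize z 2 = z2 at *
  -- This pairs the gradient of the gap with the numerator of `pointField`. The numerator is
  -- orthogonal to `x`, so the radial part drops out; what remains is `-(R²r² - i²)`, which contains
  -- the factor `g = Rr - i` and so cancels one power of the gap. The numerator itself has
  -- divergence `-2i`, and `(Rr + i) - 2i = g` leaves a constant.
  have hS : (R * (r⁻¹ * x0) - z0) * (r ^ 2 * z0 - i * x0) +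
      (R * (r⁻¹ * x1) - z1) * (r ^ 2 * z1 - i * x1) +
      (R * (r⁻¹ * x2) - z2) * (r ^ 2 * z2 - i * x2) = -(g * (R * r + i)) := by
    have e : (R * (r⁻¹ * x0) - z0) * (r ^ 2 * z0 - i * x0) +
      (R * (r⁻¹ * x1) - z1) * (r ^ 2 * z1 - i * x1) +
      (R * (r⁻¹ * x2) - z2) * (r ^ 2 * z2 - i * x2) =
      R * r⁻¹ * (r ^ 2 * (x0 * z0 + x1 * z1 + x2 * z2) - i * (x0 ^ 2 + x1 ^ 2 + x2 ^ 2)) -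
      (r ^ 2 * (z0 ^ 2 + z1 ^ 2 + z2 ^ 2) - i * (x0 * z0 + x1 * z1 + x2 * z2)) := by ring
    rw [e, ← hi, ← hx3, ← hz3, hg]; ring
  calc _ = (g⁻¹ * ((R ^ 2)⁻¹ * 2⁻¹)) * ((x0 * z0 + x1 * z1 + x2 * z2) - 3 * i) -
        ((2 * R ^ 2 * g) ^ 2)⁻¹ * (2 * R ^ 2) * ((R * (r⁻¹ * x0) - z0) * (r ^ 2 * z0 - i * x0) +
        (R * (r⁻¹ * x1) - z1) * (r ^ 2 * z1 - i * x1) +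
        (R * (r⁻¹ * x2) - z2) * (r ^ 2 * z2 - i * x2)) := by ring
    _ = _ := by
      rw [hS, ← hi]
      field_simp
      rw [hg]; ring

theorem divergence_coneField (hR : 0 < R) (hL : ∀ z ∈ L, ‖z‖ = R) (hx : x ≠ 0)
    (h : gapProd R L x ≠ 0) : divergence (coneField R L) x = L.card / (2 * R ^ 2) := by
  have hd : ∀ z ∈ L, DifferentiableAt ℝ (pointField R z) x := fun z hz =>
    (contDiffAt_pointField hR hx (gap_ne_zero_of_gapProd h hz)).differentiableAt one_ne_zero
  have h1 : divergence (coneField R L) x = ∑ z ∈ L, divergence (pointField R z) x := by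
    have : coneField R L = fun x => ∑ z ∈ L, pointField R z x := rfl
    simp only [divergence]
    rw [Finset.sum_comm, this, fderiv_fun_sum hd]
    simp
  rw [h1, Finset.sum_congr rfl fun z hz =>
    divergence_pointField hR (hL z hz) hx (gap_ne_zero_of_gapProd h hz)]
  simp [div_eq_mul_inv]

theorem divergence_cutField (hR : 0 < R) (hL : ∀ z ∈ L, ‖z‖ = R) (hε : 0 < ε) (hx : x ∈ shell R)
    (h : ε < gapProd R L x) : divergence (cutField R hR L ε) x = L.card / (2 * R ^ 2) := by
  have hx0 := ne_zero_of_mem_shell hx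
  rw [← divergence_coneField hR hL hx0 (hε.trans h).ne']
  have : cutField R hR L ε =ᶠ[nhds x] coneField R L := by
    filter_upwards [(isOpen_shell R).mem_nhds hx,
      continuousAt_const.eventually_lt (contDiffAt_gapProd hx0).continuousAt h] with y hy hy'
    exact cutField_eq hR hε hy hy'.le
  simp only [divergence, this.fderiv_eq]

theorem hasDerivAt_gap_div_norm {γ : ℝ → E3} {v : E3} {t : ℝ} (hγ : HasDerivAt γ v t)
    (hv : ⟪γ t, v⟫ = 0) (h0 : γ t ≠ 0) :
    HasDerivAt (fun s => gap R z (γ s) / ‖γ s‖) (-(⟪v, z⟫ / ‖γ t‖)) t := by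
  have h1 : HasDerivAt (fun s => ‖γ s‖) 0 t := by
    have := (hasFDerivAt_norm_of_ne_zero h0).comp_hasDerivAt t hγ
    simpa [hv, Function.comp_def] using this
  have h2 : HasDerivAt (fun s => gap R z (γ s)) (-⟪v, z⟫) t := by
    have := (h1.const_mul R).fun_sub (hγ.inner ℝ (hasDerivAt_const t z))
    simpa [gap] using this
  have := h2.fun_div h1 (norm_ne_zero_iff.2 h0)
  refine this.congr_deriv ?_
  have : ‖γ t‖ ≠ 0 := norm_ne_zero_iff.2 h0
  field_simp
  ring

theorem inner_coneField_of_inner_eq_zero {v : E3} (hv : ⟪x, v⟫ = 0) :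
    ⟪v, coneField R L x⟫ = ‖x‖ ^ 2 / (2 * R ^ 2) * ∑ z ∈ L, ⟪v, z⟫ / gap R z x := by
  rw [coneField, inner_sum, Finset.mul_sum]
  refine Finset.sum_congr rfl fun z _ => ?_
  rw [pointField, inner_smul_right, inner_sub_right, inner_smul_right, inner_smul_right,
    real_inner_comm x v, hv]
  simp only [mul_inv, div_eq_mul_inv]
  ring

/-- The logarithmic derivative of `gapProd` along a tangent velocity `v` is, up to a factor, `-⟪v,
coneField⟫`; for `v = χ • coneField` this is a negative multiple of a square. At zeros of the
product, where the logarithm is meaningless, `hP` makes the velocity vanish. -/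
theorem hasDerivAt_gapProd {γ : ℝ → E3} {χ t : ℝ} (hR : 0 < R)
    (hγ : HasDerivAt γ (χ • coneField R L (γ t)) t) (h0 : γ t ≠ 0)
    (hP : gapProd R L (γ t) = 0 → χ = 0) :
    HasDerivAt (fun s => gapProd R L (γ s))
      (-(χ * gapProd R L (γ t) * (2 * R ^ 2 / ‖γ t‖ ^ 2) * ‖coneField R L (γ t)‖ ^ 2)) t := by
  set v := χ • coneField R L (γ t) with hvdef
  have hv : ⟪γ t, v⟫ = 0 := by rw [hvdef, inner_smul_right, inner_coneField, mul_zero]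
  have h := HasDerivAt.fun_finsetProd (u := L) (f := fun z s => gap R z (γ s) / ‖γ s‖)
    fun z _ => hasDerivAt_gap_div_norm (R := R) (z := z) hγ hv h0
  refine h.congr_deriv ?_
  by_cases hχ : χ = 0
  · simp [hvdef, hχ]
  have hn : ‖γ t‖ ≠ 0 := norm_ne_zero_iff.2 h0
  have hP' : gapProd R L (γ t) ≠ 0 := fun h => hχ (hP h)
  have h1 := inner_coneField_of_inner_eq_zero (R := R) (L := L) hv
  rw [hvdef, real_inner_smul_left, real_inner_self_eq_norm_sq, ← hvdef] at h1
  have h2 : ∀ z ∈ L, (∏ w ∈ L.erase z, gap R w (γ t) / ‖γ t‖) • (-(⟪v, z⟫ / ‖γ t‖)) =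
      -(gapProd R L (γ t) * (⟪v, z⟫ / gap R z (γ t))) := by
    intro z hz
    have hg := gap_ne_zero_of_gapProd hP' hz
    rw [gapProd, ← Finset.mul_prod_erase L _ hz, smul_eq_mul]
    field_simp
  rw [Finset.sum_congr rfl h2, Finset.sum_neg_distrib, ← Finset.mul_sum]
  have h3 : ∑ z ∈ L, ⟪v, z⟫ / gap R z (γ t) =
      2 * R ^ 2 / ‖γ t‖ ^ 2 * (χ * ‖coneField R L (γ t)‖ ^ 2) := by
    rw [h1]; field_simp
  rw [h3]; ring

theorem force_eq_coneField (hR : 0 < R) (hL : ∀ z ∈ L, ‖z‖ = R) (hx : ‖x‖ = R) (hxL : x ∉ L) :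
    force L x = coneField R L x := by
  have hne : ∀ z ∈ L, x - z ≠ 0 := fun z hz h => hxL (sub_eq_zero.1 h ▸ hz)
  have hgrad : gradient (potential L) x = ∑ z ∈ L, (‖x - z‖ ^ 2)⁻¹ • (x - z) := by
    refine HasGradientAt.gradient ?_
    rw [hasGradientAt_iff_hasFDerivAt]
    have h := HasFDerivAt.fun_sum (u := L) fun z hz =>
      (((hasFDerivAt_norm_of_ne_zero (hne z hz)).comp x ((hasFDerivAt_id x).sub_const z)).log
        (norm_ne_zero_iff.2 (hne z hz)))
    refine h.congr_fderiv ?_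
    ext v
    simp [pow_two, mul_assoc]
  rw [force, hgrad, map_sum, ← Finset.sum_neg_distrib, coneField]
  refine Finset.sum_congr rfl fun z hz => ?_
  rw [Submodule.starProjection_orthogonal_val, Submodule.starProjection_singleton]
  have hgap : ‖x - z‖ ^ 2 = 2 * gap R z x := by
    rw [norm_sub_sq_real, hx, hL z hz, gap, hx]; ring
  have hg : gap R z x ≠ 0 := fun h => hne z hz (by simpa [h] using hgap)
  rw [pointField, hgap, inner_smul_right, inner_sub_right, real_inner_self_eq_norm_sq, hx]
  have hgx : ⟪x, z⟫ = R ^ 2 - gap R z x := by rw [gap, hx]; ring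
  simp only [RCLike.ofReal_real_eq_id, id, hgx]
  match_scalars <;> field_simp; ring

end Field

/-! ### The flow of the cut-off field: invariants, monotonicity and volume. -/

section CutFlow

open Set
open scoped NNReal

variable {R : ℝ} {x : E3} {L : Finset E3} {ε : ℝ}

open Classical in
/-- The flow of `cutField`. -/
noncomputable def cutFlow (R : ℝ) (hR : 0 < R) (L : Finset E3) (ε : ℝ) : ℝ → E3 → E3 :=
  if h : ∃ Φ, IsFlow (cutField R hR L ε) Φ then h.choose else fun _ x => x

theorem exists_lipschitzWith_cutField (hR : 0 < R) (hε : 0 < ε) :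
    ∃ K, LipschitzWith K (cutField R hR L ε) :=
  (contDiff_cutField hR hε).lipschitzWith_of_hasCompactSupport (hasCompactSupport_cutField hR)
    one_ne_zero

theorem isFlow_cutFlow (hR : 0 < R) (hε : 0 < ε) :
    IsFlow (cutField R hR L ε) (cutFlow R hR L ε) := by
  obtain ⟨K, hK⟩ := exists_lipschitzWith_cutField (L := L) hR hε
  obtain ⟨B, hB⟩ := (hasCompactSupport_cutField (L := L) (ε := ε) hR).exists_bound_of_continuous
    (contDiff_cutField hR hε).continuous
  have h : ∃ Φ, IsFlow (cutField R hR L ε) Φ :=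
    exists_isFlow (L := B.toNNReal) hK fun x => (hB x).trans (Real.le_coe_toNNReal _)
  rw [cutFlow, dif_pos h]
  exact h.choose_spec

theorem continuous_cutFlow_uncurry (hR : 0 < R) (hε : 0 < ε) :
    Continuous fun p : ℝ × E3 => cutFlow R hR L ε p.1 p.2 := by
  obtain ⟨K, hK⟩ := exists_lipschitzWith_cutField (L := L) hR hε
  exact (isFlow_cutFlow hR hε).continuous_uncurry hK

theorem norm_cutFlow (hR : 0 < R) (hε : 0 < ε) (t : ℝ) (x : E3) :
    ‖cutFlow R hR L ε t x‖ = ‖x‖ := by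
  have hΦ := isFlow_cutFlow (L := L) hR hε
  have hd : ∀ t, HasDerivAt (fun t => ‖cutFlow R hR L ε t x‖ ^ 2) 0 t := fun t => by
    have := (hΦ.hasDerivAt x t).norm_sq
    rwa [inner_cutField, mul_zero] at this
  have := is_const_of_deriv_eq_zero (fun t => (hd t).differentiableAt) (fun t => (hd t).deriv) t 0
  rw [hΦ.zero] at this
  exact (sq_eq_sq₀ (norm_nonneg _) (norm_nonneg _)).1 this

theorem cutFlow_ne_zero (hR : 0 < R) (hε : 0 < ε) (hx : x ≠ 0) (t : ℝ) :
    cutFlow R hR L ε t x ≠ 0 := by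
  rw [← norm_ne_zero_iff, norm_cutFlow hR hε]
  exact norm_ne_zero_iff.2 hx

theorem hasDerivAt_gapProd_cutFlow (hR : 0 < R) (hε : 0 < ε) (hx : x ≠ 0) (t : ℝ) :
    ∃ d, HasDerivAt (fun t => gapProd R L (cutFlow R hR L ε t x))
      (-(cutoff R hR L ε (cutFlow R hR L ε t x) * gapProd R L (cutFlow R hR L ε t x) * d ^ 2)) t := by
  have h0 := cutFlow_ne_zero (L := L) hR hε hx t
  refine ⟨√2 * R / ‖cutFlow R hR L ε t x‖ * ‖coneField R L (cutFlow R hR L ε t x)‖, ?_⟩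
  have := hasDerivAt_gapProd hR ((isFlow_cutFlow (L := L) hR hε).hasDerivAt x t) h0
    (fun h => cutoff_eq_zero_of_gapProd_le hR hε (by rw [h]; positivity))
  refine this.congr_deriv ?_
  rw [mul_pow, div_pow, mul_pow, Real.sq_sqrt (by norm_num)]
  ring

theorem antitone_gapProd_cutFlow (hR : 0 < R) (hL : ∀ z ∈ L, ‖z‖ = R) (hε : 0 < ε) (hx : x ≠ 0) :
    Antitone fun t => gapProd R L (cutFlow R hR L ε t x) := by
  choose d hd using hasDerivAt_gapProd_cutFlow (L := L) hR hε hx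
  refine antitone_of_deriv_nonpos (fun t => (hd t).differentiableAt) fun t => ?_
  rw [(hd t).deriv, Left.neg_nonpos_iff]
  exact mul_nonneg (mul_nonneg (cutoff_nonneg hR _) (gapProd_nonneg hL _)) (sq_nonneg _)

theorem continuous_gapProd_cutFlow (hR : 0 < R) (hε : 0 < ε) (hx : x ≠ 0) :
    Continuous fun t => gapProd R L (cutFlow R hR L ε t x) :=
  continuous_iff_continuousAt.2 fun t => (hasDerivAt_gapProd_cutFlow hR hε hx t).choose_spec.continuousAt

theorem mem_shell_cutFlow_iff (hR : 0 < R) (hε : 0 < ε) (t : ℝ) :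
    cutFlow R hR L ε t x ∈ shell R ↔ x ∈ shell R := by
  simp only [shell, mem_ofPred_eq, norm_cutFlow hR hε]

/-- Inside the shell the cut-off field is still homogeneous of degree one, since `gapProd` depends
only on the direction; hence a dilated orbit is an orbit. -/
theorem cutFlow_smul (hR : 0 < R) (hε : 0 < ε) {s : ℝ} (hs : 0 < s) (hx : x ∈ shell R)
    (hsx : s • x ∈ shell R) (t : ℝ) :
    cutFlow R hR L ε t (s • x) = s • cutFlow R hR L ε t x := by
  obtain ⟨K, hK⟩ := exists_lipschitzWith_cutField (L := L) hR hε
  have hΦ := isFlow_cutFlow (L := L) hR hε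
  have := hΦ.eqOn hK (γ := fun t => s • cutFlow R hR L ε t x) ordConnected_univ (mem_univ _)
    (fun r _ => by
      have hr : s • cutFlow R hR L ε r x ∈ shell R := by
        simp only [shell, mem_ofPred_eq, norm_smul, norm_cutFlow hR hε] at hsx ⊢
        exact hsx
      rw [cutField_smul hR hs ((mem_shell_cutFlow_iff hR hε r).2 hx) hr]
      exact (hΦ.hasDerivAt x r).const_smul s) (mem_univ t)
  simpa [hΦ.zero] using this.symm

theorem isOpen_shell_inter_lt_gapProd (R ε : ℝ) (L : Finset E3) :
    IsOpen (shell R ∩ {x | ε < gapProd R L x}) :=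
  ContinuousOn.isOpen_inter_preimage (t := Ioi ε) (fun _ hx =>
    (contDiffAt_gapProd (ne_zero_of_mem_shell hx)).continuousAt.continuousWithinAt)
    (isOpen_shell R) isOpen_Ioi

theorem volume_preimage_cutFlow (hR : 0 < R) (hL : ∀ z ∈ L, ‖z‖ = R) (hε : 0 < ε) {t : ℝ}
    (ht : 0 ≤ t) {A : Set E3} (hA : MeasurableSet A) (hAs : A ⊆ shell R ∩ {x | ε < gapProd R L x}) :
    volume (cutFlow R hR L ε t ⁻¹' A) =
      ENNReal.ofReal (Real.exp (-(L.card / (2 * R ^ 2)) * t)) * volume A := by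
  obtain ⟨K, hK⟩ := exists_lipschitzWith_cutField (L := L) hR hε
  have hΦ := isFlow_cutFlow (L := L) hR hε
  refine hΦ.volume_preimage hK (contDiff_cutField hR hε) (hasCompactSupport_cutField hR)
    (isOpen_shell_inter_lt_gapProd R ε L) ((isBounded_shell hR).subset inter_subset_left)
    (fun s hs x hx => ?_) ht hA hAs
  have hxs := (mem_shell_cutFlow_iff hR hε s).1 hx.1
  -- `gapProd` only decreases in forward time, so a point whose orbit lies above `ε` at time `s` was
  -- above `ε` at the start, where the cutoff is inactive.
  refine divergence_cutField hR hL hε hxs (lt_of_lt_of_le hx.2 ?_)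
  have := antitone_gapProd_cutFlow hR hL hε (ne_zero_of_mem_shell hxs) hs
  simpa only [hΦ.zero] using this

end CutFlow

/-! ### Maximal integral curves of the force. -/

section FlowCurve

open Set

variable {n : ℕ} {L : Finset E3} {x : E3} {ε : ℝ}

theorem radius_pos (hn : 0 < n) : 0 < radius n :=
  Real.sqrt_pos.2 (by have : (0 : ℝ) < n := by exact_mod_cast hn
                      positivity)

theorem norm_of_mem_sphereN (hx : x ∈ sphereN n) : ‖x‖ = radius n := by
  simpa [sphereN] using hx

theorem ne_zero_of_mem_sphereN (hR : 0 < radius n) (hx : x ∈ sphereN n) : x ≠ 0 := by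
  rw [← norm_pos_iff, norm_of_mem_sphereN hx]; exact hR

theorem IsFlowCurve.hasDerivAt {γ : ℝ → E3} {I : Set ℝ} (h : IsFlowCurve n L x γ I) {t : ℝ}
    (ht : t ∈ I) : HasDerivAt γ (force L (γ t)) t :=
  (h.integralCurve t ht).hasDerivAt (h.isOpen.mem_nhds ht)

theorem cutFlow_mem_sphereN (hR : 0 < radius n) (hε : 0 < ε) (hx : x ∈ sphereN n) (t : ℝ) :
    cutFlow (radius n) hR L ε t x ∈ sphereN n := by
  simp [sphereN, norm_cutFlow hR hε, norm_of_mem_sphereN hx]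

theorem cutField_eq_force (hR : 0 < radius n) (hL : ∀ z ∈ L, ‖z‖ = radius n) (hε : 0 < ε)
    (hx : x ∈ sphereN n) (h : ε ≤ gapProd (radius n) L x) :
    cutField (radius n) hR L ε x = force L x := by
  have hx' := norm_of_mem_sphereN hx
  rw [cutField_eq hR hε (mem_shell_of_norm_eq hR hx') h, force_eq_coneField hR hL hx']
  intro hxL
  rw [(gapProd_eq_zero_iff hR hL hx').2 hxL] at h
  linarith

theorem isFlowCurve_cutFlow (hR : 0 < radius n) (hL : ∀ z ∈ L, ‖z‖ = radius n) (hε : 0 < ε)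
    (hx : x ∈ sphereN n) (h : ε < gapProd (radius n) L x) :
    IsFlowCurve n L x (fun t => cutFlow (radius n) hR L ε t x)
      {t | ε < gapProd (radius n) L (cutFlow (radius n) hR L ε t x)} := by
  have hΦ := isFlow_cutFlow (L := L) hR hε
  have hx0 := ne_zero_of_mem_sphereN hR hx
  have hmem := cutFlow_mem_sphereN (L := L) hR hε hx
  refine ⟨isOpen_lt continuous_const (continuous_gapProd_cutFlow hR hε hx0), ⟨?_⟩, ?_, hΦ.zero x,
    fun t ht => ⟨hmem t, fun hL' => ?_⟩, fun t ht => ?_⟩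
  · intro a _ b hb t ht
    exact lt_of_lt_of_le hb (antitone_gapProd_cutFlow hR hL hε hx0 ht.2)
  · simpa only [mem_ofPred_eq, hΦ.zero] using h
  · have := (gapProd_eq_zero_iff hR hL (norm_of_mem_sphereN (hmem t))).2 hL'
    rw [mem_ofPred_eq, this] at ht
    exact lt_asymm hε ht
  · change HasDerivWithinAt _ (force L (cutFlow (radius n) hR L ε t x)) _ _
    rw [← cutField_eq_force hR hL hε (hmem t) (le_of_lt ht)]
    exact (hΦ.hasDerivAt x t).hasDerivWithinAt

/-- On the compact time interval between `0` and `t` the curve keeps `gapProd` above a positive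
minimum `δ`. For `ε < δ` it therefore solves the cut-off equation, whose field is globally
Lipschitz; uniqueness for the force is inherited from there. -/
theorem IsFlowCurve.exists_eq_cutFlow (hR : 0 < radius n) (hL : ∀ z ∈ L, ‖z‖ = radius n)
    {γ : ℝ → E3} {I : Set ℝ} (h : IsFlowCurve n L x γ I) {t : ℝ} (ht : t ∈ I) :
    ∃ δ > 0, ∀ ε, 0 < ε → ε < δ → ε < gapProd (radius n) L (cutFlow (radius n) hR L ε t x) ∧
      γ t = cutFlow (radius n) hR L ε t x := by
  have hJ : uIcc 0 t ⊆ I := h.ordConnected.uIcc_subset h.zero_mem ht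
  have hcont : ContinuousOn (fun s => gapProd (radius n) L (γ s)) (uIcc 0 t) := fun s hs =>
    ((contDiffAt_gapProd (ne_zero_of_mem_sphereN hR (h.mem s (hJ hs)).1)).continuousAt.comp
      (h.hasDerivAt (hJ hs)).continuousAt).continuousWithinAt
  obtain ⟨s₀, hs₀, hmin⟩ := isCompact_uIcc.exists_isMinOn nonempty_uIcc hcont
  have hs₀' := h.mem s₀ (hJ hs₀)
  refine ⟨gapProd (radius n) L (γ s₀), gapProd_pos hR hL (norm_of_mem_sphereN hs₀'.1) hs₀'.2,
    fun ε hε hlt => ?_⟩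
  obtain ⟨K, hK⟩ := exists_lipschitzWith_cutField (L := L) hR hε
  have heq : γ t = cutFlow (radius n) hR L ε t x := by
    have := (isFlow_cutFlow (L := L) hR hε).eqOn hK (γ := γ) (I := uIcc 0 t) ordConnected_uIcc
      left_mem_uIcc (fun s hs => ?_) right_mem_uIcc
    · rwa [h.initial] at this
    · rw [cutField_eq_force hR hL hε (h.mem s (hJ hs)).1 (hlt.le.trans (hmin hs))]
      exact h.hasDerivAt (hJ hs)
  exact ⟨heq ▸ hlt.trans_le (hmin right_mem_uIcc), heq⟩

theorem IsFlowCurve.eq_of_mem (hR : 0 < radius n) (hL : ∀ z ∈ L, ‖z‖ = radius n)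
    {γ γ' : ℝ → E3} {I I' : Set ℝ} (h : IsFlowCurve n L x γ I) (h' : IsFlowCurve n L x γ' I')
    {t : ℝ} (ht : t ∈ I) (ht' : t ∈ I') : γ t = γ' t := by
  obtain ⟨δ, hδ, H⟩ := h.exists_eq_cutFlow hR hL ht
  obtain ⟨δ', hδ', H'⟩ := h'.exists_eq_cutFlow hR hL ht'
  obtain ⟨ε, hε, hlt⟩ := exists_between (lt_min hδ hδ')
  rw [(H ε hε (hlt.trans_le (min_le_left _ _))).2, (H' ε hε (hlt.trans_le (min_le_right _ _))).2]

theorem IsFlowCurve.trajectory_eq (hR : 0 < radius n) (hL : ∀ z ∈ L, ‖z‖ = radius n)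
    {γ : ℝ → E3} {I : Set ℝ} (h : IsFlowCurve n L x γ I) {t : ℝ} (ht : t ∈ I) :
    trajectory n L x t = γ t := by
  have hd : t ∈ flowDomain n L x := ⟨γ, I, h, ht⟩
  rw [trajectory, dif_pos hd]
  obtain ⟨I', h', ht'⟩ := hd.choose_spec
  exact h'.eq_of_mem hR hL h ht' ht

theorem mem_flowDomain_iff (hR : 0 < radius n) (hL : ∀ z ∈ L, ‖z‖ = radius n)
    (hx : x ∈ sphereN n \ L) {t : ℝ} : t ∈ flowDomain n L x ↔ ∃ δ > 0, ∀ ε, 0 < ε → ε < δ →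
      ε < gapProd (radius n) L x ∧
      ε < gapProd (radius n) L (cutFlow (radius n) hR L ε t x) := by
  have hP := gapProd_pos hR hL (norm_of_mem_sphereN hx.1) hx.2
  constructor
  · rintro ⟨γ, I, h, ht⟩
    obtain ⟨δ, hδ, H⟩ := h.exists_eq_cutFlow hR hL ht
    exact ⟨min δ (gapProd (radius n) L x), lt_min hδ hP, fun ε hε hlt =>
      ⟨hlt.trans_le (min_le_right _ _), (H ε hε (hlt.trans_le (min_le_left _ _))).1⟩⟩
  · rintro ⟨δ, hδ, H⟩
    obtain ⟨ε, hε, hlt⟩ := exists_between hδ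
    exact ⟨_, _, isFlowCurve_cutFlow hR hL hε hx.1 (H ε hε hlt).1, (H ε hε hlt).2⟩

/-- At earlier times `gapProd` is larger, so no singularity is met backward in time; this makes the
domain unbounded below. -/
theorem mem_flowDomain_of_le (hR : 0 < radius n) (hL : ∀ z ∈ L, ‖z‖ = radius n)
    (hx : x ∈ sphereN n \ L) {s t : ℝ} (hst : s ≤ t) (ht : t ∈ flowDomain n L x) :
    s ∈ flowDomain n L x := by
  rw [mem_flowDomain_iff hR hL hx] at ht ⊢
  obtain ⟨δ, hδ, H⟩ := ht
  exact ⟨δ, hδ, fun ε hε hlt => ⟨(H ε hε hlt).1, (H ε hε hlt).2.trans_le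
    (antitone_gapProd_cutFlow hR hL hε (ne_zero_of_mem_sphereN hR hx.1) hst)⟩⟩

theorem zero_mem_flowDomain (hR : 0 < radius n) (hL : ∀ z ∈ L, ‖z‖ = radius n)
    (hx : x ∈ sphereN n \ L) : (0 : ℝ) ∈ flowDomain n L x := by
  obtain ⟨ε, hε, hlt⟩ := exists_between (gapProd_pos hR hL (norm_of_mem_sphereN hx.1) hx.2)
  have := isFlowCurve_cutFlow hR hL hε hx.1 hlt
  exact ⟨_, _, this, this.zero_mem⟩

theorem isOpen_flowDomain (n : ℕ) (L : Finset E3) (x : E3) : IsOpen (flowDomain n L x) := by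
  refine isOpen_iff_mem_nhds.2 fun t ⟨γ, I, h, ht⟩ => ?_
  filter_upwards [h.isOpen.mem_nhds ht] with s hs using ⟨γ, I, h, hs⟩

theorem coe_lt_exitTime_iff (hR : 0 < radius n) (hL : ∀ z ∈ L, ‖z‖ = radius n)
    (hx : x ∈ sphereN n \ L) {t : ℝ} : (t : EReal) < exitTime n L x ↔ t ∈ flowDomain n L x := by
  rw [exitTime, lt_sSup_iff]
  constructor
  · rintro ⟨_, ⟨s, hs, rfl⟩, hlt⟩
    exact mem_flowDomain_of_le hR hL hx (EReal.coe_lt_coe_iff.1 hlt).le hs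
  · intro ht
    -- The domain is open, so it contains a time beyond `t` and the supremum is not attained.
    obtain ⟨s, hs, hts⟩ := Filter.Eventually.exists (f := nhdsWithin t (Ioi t))
      (Filter.Eventually.and (nhdsWithin_le_nhds ((isOpen_flowDomain n L x).mem_nhds ht))
        self_mem_nhdsWithin)
    exact ⟨s, ⟨s, hs, rfl⟩, EReal.coe_lt_coe_iff.2 hts⟩

theorem isFlowCurve_trajectory (hR : 0 < radius n) (hL : ∀ z ∈ L, ‖z‖ = radius n)
    (hx : x ∈ sphereN n \ L) : IsFlowCurve n L x (trajectory n L x) (flowDomain n L x) where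
  isOpen := isOpen_flowDomain n L x
  ordConnected := ⟨fun _ _ _ hb _ ht => mem_flowDomain_of_le hR hL hx ht.2 hb⟩
  zero_mem := zero_mem_flowDomain hR hL hx
  initial := by
    obtain ⟨γ, I, h, ht⟩ := zero_mem_flowDomain hR hL hx
    rw [h.trajectory_eq hR hL ht, h.initial]
  mem t := fun ⟨γ, I, h, ht⟩ => by
    rw [h.trajectory_eq hR hL ht]
    exact h.mem t ht
  integralCurve t := fun ⟨γ, I, h, ht⟩ => by
    have hev : trajectory n L x =ᶠ[nhds t] γ := by
      filter_upwards [h.isOpen.mem_nhds ht] with s hs using h.trajectory_eq hR hL hs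
    have := (h.hasDerivAt ht).congr_of_eventuallyEq hev
    rw [← hev.eq_of_nhds] at this
    exact this.hasDerivWithinAt

theorem isMaximalFlowCurve_trajectory (hR : 0 < radius n) (hL : ∀ z ∈ L, ‖z‖ = radius n)
    (hx : x ∈ sphereN n \ L) : 0 < exitTime n L x ∧
      IsMaximalFlowCurve n L x (trajectory n L x) {t : ℝ | (t : EReal) < exitTime n L x} := by
  have heq : {t : ℝ | (t : EReal) < exitTime n L x} = flowDomain n L x :=
    Set.ext fun t => coe_lt_exitTime_iff hR hL hx
  rw [heq]
  refine ⟨(coe_lt_exitTime_iff hR hL hx).2 (zero_mem_flowDomain hR hL hx),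
    isFlowCurve_trajectory hR hL hx, fun γ I h => ⟨fun t ht => ⟨γ, I, h, ht⟩, fun t ht => ?_⟩⟩
  exact (h.trajectory_eq hR hL ht).symm

end FlowCurve

/-! ### Area on the sphere: comparison with volume, transport by the flow, integrability of the
force. -/

section Area

open Set
open scoped ENNReal

variable {n : ℕ} {L : Finset E3} {x z : E3} {ε : ℝ}

instance : IsFiniteMeasure (area n) := by
  have : IsFiniteMeasure ((volume : Measure E3).toSphere.map
      fun u : Metric.sphere (0 : E3) 1 => radius n • (u : E3)) := inferInstance
  exact Measure.smul_finite _ ENNReal.ofReal_ne_top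

theorem area_apply {A : Set E3} (hA : MeasurableSet A) :
    area n A = ENNReal.ofReal (radius n ^ 2) *
      (volume : Measure E3).toSphere {u | radius n • (u : E3) ∈ A} := by
  have hm : Measurable fun u : Metric.sphere (0 : E3) 1 => radius n • (u : E3) := by fun_prop
  rw [area, Measure.smul_apply, Measure.map_apply hm hA, smul_eq_mul]
  rfl

theorem ae_mem_sphereN (n : ℕ) : ∀ᵐ x ∂(area n), x ∈ sphereN n := by
  rw [ae_iff, show {x | x ∉ sphereN n} = (sphereN n)ᶜ from rfl,
    area_apply (show MeasurableSet (sphereN n)ᶜ from Metric.isClosed_sphere.measurableSet.compl)]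
  have : {u : Metric.sphere (0 : E3) 1 | radius n • (u : E3) ∈ (sphereN n)ᶜ} = ∅ := by
    refine eq_empty_of_forall_notMem fun u hu => hu ?_
    simp [sphereN, norm_smul, abs_of_nonneg (Real.sqrt_nonneg _), radius]
  rw [this]; simp

/-- The radial projection onto the sphere of radius `R`. -/
noncomputable def radialProj (R : ℝ) (x : E3) : E3 := (R * ‖x‖⁻¹) • x

theorem measurable_radialProj (R : ℝ) : Measurable (radialProj R) := by
  unfold radialProj; fun_prop

theorem norm_radialProj {R : ℝ} (hR : 0 < R) (hx : x ≠ 0) : ‖radialProj R x‖ = R := by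
  have : ‖x‖ ≠ 0 := norm_ne_zero_iff.2 hx
  rw [radialProj, norm_smul, norm_mul, norm_inv, norm_norm, Real.norm_eq_abs, abs_of_pos hR]
  field_simp

/-- In polar coordinates the part of the shell over `A` is a product of a spherical set and the
radial interval `J`, so `κ` is the radial mass divided by `R²`. It is nonzero because the shell is
open and nonempty. -/
theorem exists_volume_shell_eq_mul_area (hR : 0 < radius n) : ∃ κ : ℝ≥0∞, κ ≠ 0 ∧ κ ≠ ∞ ∧
    ∀ A : Set E3, MeasurableSet A →
      volume (shell (radius n) ∩ radialProj (radius n) ⁻¹' A) = κ * area n A := by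
  set R := radius n with hRdef
  let J : Set (Ioi (0 : ℝ)) := {r | 3 / 4 * R ^ 2 < (r : ℝ) ^ 2 ∧ (r : ℝ) ^ 2 < 5 / 4 * R ^ 2}
  have hfin : Measure.volumeIoiPow 2 J ≠ ∞ := by
    refine ne_top_of_le_ne_top ?_ (measure_mono
      (t := Iio (⟨2 * R, mem_Ioi.2 (by positivity)⟩ : Ioi (0 : ℝ))) ?_)
    · rw [Measure.volumeIoiPow_apply_Iio]; exact ENNReal.ofReal_ne_top
    · intro r hr
      have : (r : ℝ) < 2 * R :=
        lt_of_pow_lt_pow_left₀ 2 (by positivity) (by nlinarith [hr.2, pow_pos hR 2])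
      exact this
  have h0 : ENNReal.ofReal (R ^ 2) ≠ 0 := by simpa using hR.ne'
  have key : ∀ A : Set E3, MeasurableSet A →
      volume (shell R ∩ radialProj R ⁻¹' A) =
        (Measure.volumeIoiPow 2 J / ENNReal.ofReal (R ^ 2)) * area n A := by
    intro A hA
    have hcompl : MeasurableSet ({0}ᶜ : Set E3) := (measurableSet_singleton _).compl
    have hsub : shell R ∩ radialProj R ⁻¹' A ⊆ {0}ᶜ :=
      fun x hx => ne_zero_of_mem_shell hx.1
    have h1 : volume (shell R ∩ radialProj R ⁻¹' A) = (volume.comap ((↑) : ({0}ᶜ : Set E3) → E3))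
        ((↑) ⁻¹' (shell R ∩ radialProj R ⁻¹' A)) := by
      rw [comap_subtype_coe_apply hcompl, Subtype.image_preimage_coe,
        inter_eq_self_of_subset_right hsub]
    have h2 : ((↑) ⁻¹' (shell R ∩ radialProj R ⁻¹' A) : Set ({0}ᶜ : Set E3)) =
        homeomorphUnitSphereProd E3 ⁻¹' ({u : Metric.sphere (0 : E3) 1 | R • (u : E3) ∈ A} ×ˢ J) := by
      ext x
      simp [shell, J, radialProj, smul_smul]
      tauto
    have hmp := (volume : Measure E3).measurePreserving_homeomorphUnitSphereProd
    rw [h1, h2, hmp.measure_preimage_emb (Homeomorph.measurableEmbedding _), Measure.prod_prod,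
      finrank_euclideanSpace_fin, area_apply hA, ← mul_assoc, ENNReal.div_mul_cancel h0
      ENNReal.ofReal_ne_top, mul_comm]
  refine ⟨_, fun h => ?_, ENNReal.div_ne_top hfin h0, key⟩
  have := key univ MeasurableSet.univ
  rw [h, zero_mul, preimage_univ, inter_univ] at this
  obtain ⟨v, hv⟩ := exists_norm_eq E3 hR.le
  exact (isOpen_shell R).measure_ne_zero volume ⟨v, mem_shell_of_norm_eq hR hv⟩ this

theorem area_preimage_cutFlow (hR : 0 < radius n) (hL : ∀ z ∈ L, ‖z‖ = radius n) (hε : 0 < ε)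
    {t : ℝ} (ht : 0 ≤ t) {A : Set E3} (hA : MeasurableSet A)
    (hAs : A ⊆ {x | ε < gapProd (radius n) L x}) :
    area n (cutFlow (radius n) hR L ε t ⁻¹' A) =
      ENNReal.ofReal (Real.exp (-(L.card / (2 * radius n ^ 2)) * t)) * area n A := by
  obtain ⟨κ, hκ0, hκ, H⟩ := exists_volume_shell_eq_mul_area hR
  have hm : Measurable (cutFlow (radius n) hR L ε t) :=
    ((continuous_cutFlow_uncurry hR hε).comp (Continuous.prodMk_right t)).measurable
  have hset : shell (radius n) ∩ radialProj (radius n) ⁻¹' (cutFlow (radius n) hR L ε t ⁻¹' A) =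
      cutFlow (radius n) hR L ε t ⁻¹' (shell (radius n) ∩ radialProj (radius n) ⁻¹' A) := by
    ext x
    simp only [mem_inter_iff, mem_preimage, mem_shell_cutFlow_iff hR hε]
    refine and_congr_right fun hx => ?_
    have hx0 := ne_zero_of_mem_shell hx
    have hs : 0 < radius n * ‖x‖⁻¹ := mul_pos hR (inv_pos.2 (norm_pos_iff.2 hx0))
    have := cutFlow_smul (L := L) hR hε hs hx (mem_shell_of_norm_eq hR (norm_radialProj hR hx0)) t
    rw [radialProj, this, radialProj, norm_cutFlow hR hε]
  refine (ENNReal.mul_right_inj hκ0 hκ).1 ?_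
  rw [← H _ (hm hA), hset, volume_preimage_cutFlow hR hL hε ht
    ((isOpen_shell _).measurableSet.inter (measurable_radialProj _ hA)), H _ hA]
  · ring
  · rintro x ⟨hx, hxA⟩
    refine ⟨hx, ?_⟩
    have hs : 0 < radius n * ‖x‖⁻¹ :=
      mul_pos hR (inv_pos.2 (norm_pos_iff.2 (ne_zero_of_mem_shell hx)))
    have := hAs hxA
    rwa [mem_ofPred_eq, radialProj, gapProd_smul hs] at this

theorem area_singleton (hR : 0 < radius n) (z : E3) : area n {z} = 0 := by
  obtain ⟨κ, hκ0, hκ, H⟩ := exists_volume_shell_eq_mul_area hR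
  have h : volume (shell (radius n) ∩ radialProj (radius n) ⁻¹' {z}) = 0 := by
    refine measure_mono_null (t := (Submodule.span ℝ {z} : Set E3)) ?_ ?_
    · rintro x ⟨hx, hxz⟩
      have hx0 := norm_ne_zero_iff.2 (ne_zero_of_mem_shell hx)
      refine Submodule.mem_span_singleton.2 ⟨(radius n * ‖x‖⁻¹)⁻¹, ?_⟩
      rw [← (hxz : radialProj (radius n) x = z), radialProj, smul_smul, inv_mul_cancel₀, one_smul]
      exact mul_ne_zero hR.ne' (inv_ne_zero hx0)
    · refine Measure.addHaar_submodule _ _ fun h => ?_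
      have h1 := finrank_span_le_card (R := ℝ) ({z} : Set E3)
      rw [Set.toFinset_singleton, Finset.card_singleton] at h1
      rw [h, finrank_top, finrank_euclideanSpace_fin] at h1
      omega
  rw [H _ (measurableSet_singleton z)] at h
  exact (mul_eq_zero.1 h).resolve_left hκ0

theorem ae_notMem_finset (hR : 0 < radius n) (L : Finset E3) : ∀ᵐ x ∂(area n), x ∉ L := by
  have : area n (L : Set E3) = 0 := by
    rw [← Set.biUnion_of_singleton (L : Set E3)]
    exact (measure_biUnion_null_iff L.countable_toSet).2 fun z _ => area_singleton hR z
  rw [ae_iff]; simpa using this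

/-- The part of the shell over a small ball is a tube about the ray through `z`. About `R / r` balls
of radius `3r` cover it, for a volume of order `r²`. -/
theorem exists_area_ball_le (hR : 0 < radius n) (hz : ‖z‖ = radius n) :
    ∃ C : ℝ, ∀ r, 0 < r → r ≤ radius n → area n (Metric.ball z r) ≤ ENNReal.ofReal (C * r ^ 2) := by
  obtain ⟨κ, hκ0, hκ, H⟩ := exists_volume_shell_eq_mul_area hR
  set R := radius n with hRdef
  set b := (volume : Measure E3) (Metric.ball 0 1) with hb
  have hbfin : b ≠ ∞ := measure_ball_lt_top.ne
  refine ⟨(κ⁻¹ * b).toReal * (81 * R), fun r hr hrR => ?_⟩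
  let N : ℕ := ⌊2 * R / r⌋₊ + 1
  have hcover : shell R ∩ radialProj R ⁻¹' Metric.ball z r ⊆
      -- Centers lie on the ray at spacing `r`, up to norm `2R`, which bounds the shell. Rounding
      -- the norm down costs less than `r`, and the angular error, below `r` on the sphere, is
      -- scaled by `‖x‖ / R < 2`; together less than `3r`.
      ⋃ k ∈ Finset.range N, Metric.ball ((k * r / R) • z) (3 * r) := by
    rintro x ⟨hx, hxz⟩
    have hx0 : 0 < ‖x‖ := norm_pos_iff.2 (ne_zero_of_mem_shell hx)
    have hx2 : ‖x‖ < 2 * R :=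
      lt_of_pow_lt_pow_left₀ 2 (by positivity) (by nlinarith [hx.2, pow_pos hR 2])
    have hfl := Nat.floor_le (a := ‖x‖ / r) (by positivity)
    have hfl' := Nat.lt_floor_add_one (‖x‖ / r)
    rw [le_div_iff₀ hr] at hfl
    rw [div_lt_iff₀ hr] at hfl'
    refine mem_iUnion₂.2 ⟨⌊‖x‖ / r⌋₊, ?_, ?_⟩
    · rw [Finset.mem_range, Nat.lt_add_one_iff]
      exact Nat.floor_le_floor (by gcongr)
    · set k : ℝ := (⌊‖x‖ / r⌋₊ : ℝ)
      have hsplit : x - (k * r / R) • z =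
          (‖x‖ / R) • (radialProj R x - z) + ((‖x‖ - k * r) / R) • z := by
        rw [radialProj, smul_sub, smul_smul,
          show ‖x‖ / R * (R * ‖x‖⁻¹) = 1 by field_simp]
        module
      have h1 : ‖radialProj R x - z‖ < r := by
        have := hxz; rwa [mem_preimage, Metric.mem_ball, dist_eq_norm] at this
      have h2 : ‖x‖ / R < 2 := by rwa [div_lt_iff₀ hR]
      rw [Metric.mem_ball, dist_eq_norm, hsplit]
      calc _ ≤ ‖x‖ / R * ‖radialProj R x - z‖ + |(‖x‖ - k * r) / R| * ‖z‖ := by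
            refine (norm_add_le _ _).trans (le_of_eq ?_)
            rw [norm_smul, norm_smul, Real.norm_eq_abs, Real.norm_eq_abs,
              abs_of_pos (div_pos hx0 hR)]
        _ = ‖x‖ / R * ‖radialProj R x - z‖ + (‖x‖ - k * r) := by
            rw [hz, abs_of_nonneg (div_nonneg (by linarith) hR.le)]
            field_simp
        _ < 3 * r := by
            have : ‖x‖ / R * ‖radialProj R x - z‖ ≤ 2 * r := by gcongr
            linarith
  have hvol : volume (shell R ∩ radialProj R ⁻¹' Metric.ball z r) ≤
      ENNReal.ofReal (81 * R * r ^ 2) * b := by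
    refine (measure_mono hcover).trans ((measure_biUnion_finset_le _ _).trans ?_)
    simp only [Measure.addHaar_ball _ _ (by positivity : (0 : ℝ) ≤ 3 * r),
      finrank_euclideanSpace_fin, Finset.sum_const, Finset.card_range, nsmul_eq_mul, ← hb]
    rw [← mul_assoc, ← ENNReal.ofReal_natCast, ← ENNReal.ofReal_mul (by positivity)]
    refine mul_le_mul_left (ENNReal.ofReal_le_ofReal ?_) _
    have hN : (N : ℝ) ≤ 3 * R / r := by
      have := Nat.floor_le (a := 2 * R / r) (by positivity)
      have h1 : 1 ≤ R / r := (one_le_div hr).2 hrR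
      have h3 : 3 * R / r = 2 * R / r + R / r := by ring
      simp only [N]; push_cast; linarith
    calc (N : ℝ) * (3 * r) ^ 3 ≤ 3 * R / r * (3 * r) ^ 3 := by gcongr
      _ = 81 * R * r ^ 2 := by field_simp; ring
  rw [H _ Metric.isOpen_ball.measurableSet] at hvol
  rw [mul_assoc, ENNReal.ofReal_mul ENNReal.toReal_nonneg, ENNReal.ofReal_toReal
    (ENNReal.mul_ne_top (ENNReal.inv_ne_top.2 hκ0) hbfin)]
  calc area n (Metric.ball z r) = κ⁻¹ * (κ * area n (Metric.ball z r)) := by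
        rw [← mul_assoc, ENNReal.inv_mul_cancel hκ0 hκ, one_mul]
    _ ≤ κ⁻¹ * (ENNReal.ofReal (81 * R * r ^ 2) * b) := by gcongr
    _ = _ := by ring

theorem lintegral_inv_norm_sub_lt_top (hR : 0 < radius n) (hz : ‖z‖ = radius n) :
    ∫⁻ x, ENNReal.ofReal ‖x - z‖⁻¹ ∂(area n) < ∞ := by
  obtain ⟨C, hC⟩ := exists_area_ball_le hR hz
  rw [lintegral_eq_lintegral_meas_lt (area n) (Filter.Eventually.of_forall fun x => by positivity)
    (by fun_prop)]
  have hsub : ∀ s > 0, {x | s < ‖x - z‖⁻¹} ⊆ Metric.ball z s⁻¹ := fun s hs x hx => by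
    rw [Metric.mem_ball, dist_eq_norm]
    have h : s < ‖x - z‖⁻¹ := hx
    exact (lt_inv_comm₀ hs (inv_pos.1 (hs.trans h))).1 h
  -- In the layer-cake formula levels up to `1/R` are bounded by the total area, and higher levels
  -- by `C s⁻²`, which is integrable at infinity.
  have hunion : Ioi (0 : ℝ) = Ioc 0 (radius n)⁻¹ ∪ Ioi (radius n)⁻¹ :=
    (Ioc_union_Ioi_eq_Ioi (inv_nonneg.2 hR.le)).symm
  rw [hunion]
  refine (lintegral_union_le _ _ _).trans_lt (ENNReal.add_lt_top.2 ⟨?_, ?_⟩)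
  · refine (setLIntegral_mono' measurableSet_Ioc
      (g := fun _ => area n univ) fun s _ => measure_mono (subset_univ _)).trans_lt ?_
    rw [setLIntegral_const]
    exact ENNReal.mul_lt_top (measure_lt_top _ _) measure_Ioc_lt_top
  · refine (setLIntegral_mono' measurableSet_Ioi
      (g := fun s => ENNReal.ofReal (C * s ^ (-2 : ℝ))) fun s hs => ?_).trans_lt ?_
    · have hs0 : 0 < s := (inv_pos.2 hR).trans hs
      refine (measure_mono (hsub s hs0)).trans ((hC s⁻¹ (inv_pos.2 hs0) ?_).trans (le_of_eq ?_))
      · exact (inv_le_comm₀ hs0 hR).2 (le_of_lt hs)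
      · rw [Real.rpow_neg hs0.le, inv_pow]; norm_num
    · exact ((integrableOn_Ioi_rpow_of_lt (by norm_num) (inv_pos.2 hR)).const_mul C).lintegral_lt_top

theorem norm_pointField_le {R : ℝ} (hR : 0 < R) (hz : ‖z‖ = R) (hx : ‖x‖ = R) (hxz : x ≠ z) :
    ‖pointField R z x‖ ≤ ‖x - z‖⁻¹ := by
  have hg : 0 < gap R z x := lt_of_le_of_ne (gap_nonneg hz x) fun h =>
    hxz ((gap_eq_zero_iff hR hz hx).1 h.symm)
  have hi : ⟪x, z⟫ = R ^ 2 - gap R z x := by rw [gap, hx]; ring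
  have h1 : ‖x - z‖ ^ 2 = 2 * gap R z x := by
    rw [norm_sub_sq_real, hx, hz, hi]; ring
  have h2 : ‖‖x‖ ^ 2 • z - ⟪x, z⟫ • x‖ ^ 2 = R ^ 2 * (gap R z x * (2 * R ^ 2 - gap R z x)) := by
    rw [norm_sub_sq_real, norm_smul, norm_smul, inner_smul_left, inner_smul_right,
      real_inner_comm x z, hi, mul_pow, mul_pow, hx, hz]
    simp only [Real.norm_eq_abs, sq_abs, RCLike.conj_to_real]
    ring
  refine (sq_le_sq₀ (norm_nonneg _) (by positivity)).1 ?_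
  rw [pointField, norm_smul, mul_pow, h2, inv_pow, h1, Real.norm_eq_abs, sq_abs, inv_pow,
    inv_mul_eq_div, div_le_iff₀ (by positivity)]
  have : (2 * gap R z x)⁻¹ * (2 * R ^ 2 * gap R z x) ^ 2 = R ^ 2 * (gap R z x * (2 * R ^ 2)) := by
    field_simp
  rw [this]
  gcongr
  linarith

theorem measurable_coneField (R : ℝ) (L : Finset E3) : Measurable (coneField R L) := by
  unfold coneField pointField gap
  fun_prop

theorem measurable_gapProd (R : ℝ) (L : Finset E3) : Measurable (gapProd R L) := by
  unfold gapProd gap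
  fun_prop

theorem lintegral_norm_coneField_lt_top (hR : 0 < radius n) (hL : ∀ z ∈ L, ‖z‖ = radius n) :
    ∫⁻ x, ENNReal.ofReal ‖coneField (radius n) L x‖ ∂(area n) < ∞ := by
  have hle : ∀ᵐ x ∂(area n), ENNReal.ofReal ‖coneField (radius n) L x‖ ≤
      ∑ z ∈ L, ENNReal.ofReal ‖x - z‖⁻¹ := by
    filter_upwards [ae_mem_sphereN n, ae_notMem_finset hR L] with x hx hxL
    rw [← ENNReal.ofReal_sum_of_nonneg fun z _ => by positivity]
    refine ENNReal.ofReal_le_ofReal ((norm_sum_le _ _).trans (Finset.sum_le_sum fun z hz => ?_))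
    exact norm_pointField_le hR (hL z hz) (norm_of_mem_sphereN hx) fun h => hxL (h ▸ hz)
  refine (lintegral_mono_ae hle).trans_lt ?_
  rw [lintegral_finsetSum _ fun z _ => by fun_prop]
  exact ENNReal.sum_lt_top.2 fun z hz => lintegral_inv_norm_sub_lt_top hR (hL z hz)

end Area

/-! ### Speed along the flow, and its integral over time and starting point. -/

section Length

open Set
open scoped ENNReal

variable {n : ℕ} {L : Finset E3} {x : E3} {ε : ℝ}

/-- The part of the sphere where `gapProd` is larger than `ε`. -/
def farSet (n : ℕ) (L : Finset E3) (ε : ℝ) : Set E3 :=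
  sphereN n ∩ {x | ε < gapProd (radius n) L x}

theorem measurableSet_farSet (n : ℕ) (L : Finset E3) (ε : ℝ) : MeasurableSet (farSet n L ε) :=
  Metric.isClosed_sphere.measurableSet.inter (measurable_gapProd _ _ measurableSet_Ioi)

/-- The norm of the force on `farSet n L ε`, and `0` elsewhere. -/
noncomputable def farNorm (n : ℕ) (L : Finset E3) (ε : ℝ) : E3 → ℝ≥0∞ :=
  (farSet n L ε).indicator fun x => ENNReal.ofReal ‖coneField (radius n) L x‖

theorem measurable_farNorm (n : ℕ) (L : Finset E3) (ε : ℝ) : Measurable (farNorm n L ε) :=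
  (measurable_coneField _ _).norm.ennreal_ofReal.indicator (measurableSet_farSet n L ε)

theorem lintegral_farNorm_cutFlow (hR : 0 < radius n) (hL : ∀ z ∈ L, ‖z‖ = radius n) (hε : 0 < ε)
    {t : ℝ} (ht : 0 ≤ t) :
    ∫⁻ x, farNorm n L ε (cutFlow (radius n) hR L ε t x) ∂(area n) =
      ENNReal.ofReal (Real.exp (-(L.card / (2 * radius n ^ 2)) * t)) *
        ∫⁻ x, farNorm n L ε x ∂(area n) := by
  have hm : Measurable (cutFlow (radius n) hR L ε t) :=
    ((continuous_cutFlow_uncurry hR hε).comp (Continuous.prodMk_right t)).measurable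
  have hB := measurableSet_farSet n L ε
  have hmeas : ((area n).map (cutFlow (radius n) hR L ε t)).restrict (farSet n L ε) =
      ENNReal.ofReal (Real.exp (-(L.card / (2 * radius n ^ 2)) * t)) •
        (area n).restrict (farSet n L ε) := by
    ext A hA
    rw [Measure.restrict_apply hA, Measure.map_apply hm (hA.inter hB), Measure.smul_apply,
      Measure.restrict_apply hA, smul_eq_mul]
    exact area_preimage_cutFlow hR hL hε ht (hA.inter hB) fun x hx => hx.2.2
  rw [← lintegral_map (measurable_farNorm n L ε) hm]
  simp only [farNorm]
  rw [lintegral_indicator hB, lintegral_indicator hB, hmeas, lintegral_smul_measure, smul_eq_mul]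

/-- Until `gapProd` falls to `ε` both cut-off fields equal the force along the orbit, so lowering
the level leaves it unchanged. This consistency makes `cutSpeed` monotone in the level index. -/
theorem cutFlow_eq_of_le (hR : 0 < radius n) (hL : ∀ z ∈ L, ‖z‖ = radius n) {ε' : ℝ}
    (hε' : 0 < ε') (hle : ε' ≤ ε) (hx : x ∈ sphereN n) {t : ℝ} (ht : 0 ≤ t)
    (h : ε < gapProd (radius n) L (cutFlow (radius n) hR L ε t x)) :
    cutFlow (radius n) hR L ε' t x = cutFlow (radius n) hR L ε t x := by
  have hε := hε'.trans_le hle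
  obtain ⟨K, hK⟩ := exists_lipschitzWith_cutField (L := L) hR hε'
  have hΦ := isFlow_cutFlow (L := L) hR hε
  have := (isFlow_cutFlow (L := L) hR hε').eqOn hK (γ := fun s => cutFlow (radius n) hR L ε s x)
    (I := Icc 0 t) ordConnected_Icc (left_mem_Icc.2 ht) (fun s hs => ?_) (right_mem_Icc.2 ht)
  · simp only [hΦ.zero] at this
    exact this.symm
  · have hlt : ε ≤ gapProd (radius n) L (cutFlow (radius n) hR L ε s x) :=
      (h.trans_le (antitone_gapProd_cutFlow hR hL hε (ne_zero_of_mem_sphereN hR hx) hs.2)).le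
    have hm := cutFlow_mem_sphereN (L := L) hR hε hx s
    rw [cutField_eq_force hR hL hε' hm (hle.trans hlt), ← cutField_eq_force hR hL hε hm hlt]
    exact hΦ.hasDerivAt x s

theorem mem_sphereN_of_farNorm_ne_zero (hR : 0 < radius n) (hε : 0 < ε) {t : ℝ}
    (h : farNorm n L ε (cutFlow (radius n) hR L ε t x) ≠ 0) :
    x ∈ sphereN n ∧ ε < gapProd (radius n) L (cutFlow (radius n) hR L ε t x) := by
  have hmem := mem_of_indicator_ne_zero h
  refine ⟨?_, hmem.2⟩
  have := norm_of_mem_sphereN hmem.1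
  rw [norm_cutFlow hR hε] at this
  simpa [sphereN] using this

theorem farNorm_eq_of_lt (hx : x ∈ sphereN n) (h : ε < gapProd (radius n) L x) :
    farNorm n L ε x = ENNReal.ofReal ‖coneField (radius n) L x‖ :=
  indicator_of_mem (show x ∈ farSet n L ε from ⟨hx, h⟩) _

/-- The `k`-th term of a sequence of positive numbers that decreases to zero. -/
noncomputable def level (k : ℕ) : ℝ := 1 / (k + 1)

theorem level_pos (k : ℕ) : 0 < level k := Nat.one_div_pos_of_nat

theorem level_antitone {j k : ℕ} (h : j ≤ k) : level k ≤ level j := Nat.one_div_le_one_div h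

theorem exists_level_lt {δ : ℝ} (hδ : 0 < δ) : ∃ k, level k < δ := exists_nat_one_div_lt hδ

/-- The norm of the force at time `t` along the flow that is cut off at level `k`. -/
noncomputable def cutSpeed (n : ℕ) (hR : 0 < radius n) (L : Finset E3) (k : ℕ) (t : ℝ) (x : E3) :
    ℝ≥0∞ :=
  farNorm n L (level k) (cutFlow (radius n) hR L (level k) t x)

/-- The norm of the force at time `t` along the flow, and `0` after the exit time. -/
noncomputable def speed (n : ℕ) (hR : 0 < radius n) (L : Finset E3) (t : ℝ) (x : E3) : ℝ≥0∞ :=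
  ⨆ k, cutSpeed n hR L k t x

theorem measurable_cutSpeed (hR : 0 < radius n) (L : Finset E3) (k : ℕ) :
    Measurable fun p : ℝ × E3 => cutSpeed n hR L k p.1 p.2 :=
  (measurable_farNorm n L _).comp (continuous_cutFlow_uncurry hR (level_pos k)).measurable

theorem measurable_speed (hR : 0 < radius n) (L : Finset E3) :
    Measurable fun p : ℝ × E3 => speed n hR L p.1 p.2 :=
  Measurable.iSup fun k => measurable_cutSpeed hR L k

theorem measurable_cutSpeed_apply (hR : 0 < radius n) (L : Finset E3) (k : ℕ) (t : ℝ) :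
    Measurable (cutSpeed n hR L k t) := by
  have h : Measurable (Function.uncurry (cutSpeed n hR L k)) := measurable_cutSpeed hR L k
  exact h.of_uncurry_left

theorem measurable_speed_apply (hR : 0 < radius n) (L : Finset E3) (x : E3) :
    Measurable fun t => speed n hR L t x := by
  have h : Measurable (Function.uncurry (speed n hR L)) := measurable_speed hR L
  exact h.of_uncurry_right

theorem monotone_cutSpeed (hR : 0 < radius n) (hL : ∀ z ∈ L, ‖z‖ = radius n) {t : ℝ} (ht : 0 ≤ t) :
    Monotone fun k x => cutSpeed n hR L k t x := by
  intro j k hjk x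
  by_cases h : cutSpeed n hR L j t x = 0
  · simp [h]
  obtain ⟨hx, hlt⟩ := mem_sphereN_of_farNorm_ne_zero hR (level_pos j) h
  have hm := cutFlow_mem_sphereN (L := L) hR (level_pos j) hx t
  have hle := level_antitone hjk
  simp only [cutSpeed]
  rw [cutFlow_eq_of_le hR hL (level_pos k) hle hx ht hlt, farNorm_eq_of_lt hm hlt,
    farNorm_eq_of_lt hm (hle.trans_lt hlt)]

theorem monotone_farNorm_level (n : ℕ) (L : Finset E3) :
    Monotone fun k => farNorm n L (level k) := fun _ _ hjk =>
  indicator_le_indicator_of_subset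
    (inter_subset_inter_right _ fun _ hx => (level_antitone hjk).trans_lt hx) fun _ => zero_le

theorem iSup_lintegral_farNorm (hR : 0 < radius n) (hL : ∀ z ∈ L, ‖z‖ = radius n) :
    ⨆ k, ∫⁻ x, farNorm n L (level k) x ∂(area n) =
      ∫⁻ x, ENNReal.ofReal ‖coneField (radius n) L x‖ ∂(area n) := by
  rw [← lintegral_iSup (fun k => measurable_farNorm n L _) (monotone_farNorm_level n L)]
  refine lintegral_congr_ae ?_
  filter_upwards [ae_mem_sphereN n, ae_notMem_finset hR L] with x hx hxL
  obtain ⟨k, hk⟩ := exists_level_lt (gapProd_pos hR hL (norm_of_mem_sphereN hx) hxL)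
  refine le_antisymm (iSup_le fun k => indicator_le_self _ _ _) ?_
  rw [← farNorm_eq_of_lt hx hk]
  exact le_iSup (fun k => farNorm n L (level k) x) k

/-- The identity at each cutoff level is the change of variables by `area_preimage_cutFlow`;
monotone convergence removes the cutoff on both sides. -/
theorem lintegral_speed (hR : 0 < radius n) (hL : ∀ z ∈ L, ‖z‖ = radius n) {t : ℝ} (ht : 0 ≤ t) :
    ∫⁻ x, speed n hR L t x ∂(area n) =
      ENNReal.ofReal (Real.exp (-(L.card / (2 * radius n ^ 2)) * t)) *
        ∫⁻ x, ENNReal.ofReal ‖coneField (radius n) L x‖ ∂(area n) := by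
  simp only [speed]
  rw [lintegral_iSup (fun k => measurable_cutSpeed_apply hR L k t)
    (monotone_cutSpeed hR hL ht), ← iSup_lintegral_farNorm hR hL, ENNReal.mul_iSup]
  exact iSup_congr fun k => lintegral_farNorm_cutFlow hR hL (level_pos k) ht

theorem lintegral_lintegral_speed (hR : 0 < radius n) (hL : ∀ z ∈ L, ‖z‖ = radius n)
    (hcard : 0 < L.card) :
    ∫⁻ x, ∫⁻ t in Ioi (0 : ℝ), speed n hR L t x ∂volume ∂(area n) =
      ENNReal.ofReal (L.card / (2 * radius n ^ 2))⁻¹ *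
        ∫⁻ x, ENNReal.ofReal ‖coneField (radius n) L x‖ ∂(area n) := by
  have hc : 0 < (L.card : ℝ) / (2 * radius n ^ 2) :=
    div_pos (by exact_mod_cast hcard) (by positivity)
  set c := (L.card : ℝ) / (2 * radius n ^ 2)
  have hm : Measurable (Function.uncurry fun x t => speed n hR L t x) := by
    have h := measurable_speed hR L
    generalize speed n hR L = f at h
    exact h.comp measurable_swap
  rw [lintegral_lintegral_swap hm.aemeasurable]
  rw [setLIntegral_congr_fun measurableSet_Ioi fun t ht => lintegral_speed hR hL (le_of_lt ht),
    lintegral_mul_const _ (by fun_prop)]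
  congr 1
  rw [← ofReal_integral_eq_lintegral_ofReal (integrableOn_exp_mul_Ioi (neg_neg_of_pos hc) 0)
    (Filter.Eventually.of_forall fun t => Real.exp_nonneg _),
    integral_exp_mul_Ioi (neg_neg_of_pos hc)]
  congr 1
  simp [neg_div_neg_eq]

/-- Each `cutSpeed` is either `0` or the true speed: a cut orbit that has fallen to its level is
discarded by `farNorm`. For a small enough level the true value occurs. Thus `speed` is a jointly
measurable version of the integrand of `flowLength`. -/
theorem speed_eq_of_mem_flowDomain (hR : 0 < radius n) (hL : ∀ z ∈ L, ‖z‖ = radius n)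
    (hx : x ∈ sphereN n \ L) {t : ℝ} (h0 : 0 ≤ t) (ht : t ∈ flowDomain n L x) :
    speed n hR L t x = ENNReal.ofReal ‖force L (trajectory n L x t)‖ := by
  have hmem := (isFlowCurve_trajectory hR hL hx).mem t ht
  have hval : ∀ k, level k < gapProd (radius n) L (cutFlow (radius n) hR L (level k) t x) →
      cutFlow (radius n) hR L (level k) t x = trajectory n L x t →
      cutSpeed n hR L k t x = ENNReal.ofReal ‖force L (trajectory n L x t)‖ := by
    intro k hlt heq
    rw [cutSpeed, farNorm_eq_of_lt (heq ▸ hmem.1) hlt, heq,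
      force_eq_coneField hR hL (norm_of_mem_sphereN hmem.1) hmem.2]
  refine le_antisymm (iSup_le fun k => ?_) ?_
  · by_cases h : cutSpeed n hR L k t x = 0
    · simp [h]
    have hlt := (mem_sphereN_of_farNorm_ne_zero hR (level_pos k) h).2
    have hle := antitone_gapProd_cutFlow hR hL (level_pos k) (ne_zero_of_mem_sphereN hR hx.1) h0
    simp only [(isFlow_cutFlow hR (level_pos k)).zero] at hle
    have hcurve := isFlowCurve_cutFlow hR hL (level_pos k) hx.1 (hlt.trans_le hle)
    exact (hval k hlt (hcurve.trajectory_eq hR hL hlt).symm).le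
  · obtain ⟨δ, hδ, H⟩ := (isFlowCurve_trajectory hR hL hx).exists_eq_cutFlow hR hL ht
    obtain ⟨k, hk⟩ := exists_level_lt hδ
    obtain ⟨hlt, heq⟩ := H _ (level_pos k) hk
    rw [← hval k hlt heq.symm]
    exact le_iSup (fun k => cutSpeed n hR L k t x) k

theorem speed_eq_zero_of_notMem_flowDomain (hR : 0 < radius n) (hL : ∀ z ∈ L, ‖z‖ = radius n)
    (hx : x ∈ sphereN n \ L) {t : ℝ} (h0 : 0 ≤ t) (ht : t ∉ flowDomain n L x) :
    speed n hR L t x = 0 := by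
  refine ENNReal.iSup_eq_zero.2 fun k => ?_
  by_contra h
  have hlt := (mem_sphereN_of_farNorm_ne_zero hR (level_pos k) h).2
  have := antitone_gapProd_cutFlow hR hL (level_pos k) (ne_zero_of_mem_sphereN hR hx.1) h0
  simp only [(isFlow_cutFlow hR (level_pos k)).zero] at this
  exact ht ⟨_, _, isFlowCurve_cutFlow hR hL (level_pos k) hx.1 (hlt.trans_le this), hlt⟩

theorem setOf_lt_exitTime (hR : 0 < radius n) (hL : ∀ z ∈ L, ‖z‖ = radius n)
    (hx : x ∈ sphereN n \ L) :
    {t : ℝ | 0 < t ∧ (t : EReal) < exitTime n L x} = Ioi 0 ∩ flowDomain n L x :=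
  Set.ext fun _ => and_congr_right fun _ => coe_lt_exitTime_iff hR hL hx

theorem setLIntegral_norm_force_trajectory (hR : 0 < radius n) (hL : ∀ z ∈ L, ‖z‖ = radius n)
    (hx : x ∈ sphereN n \ L) :
    AEStronglyMeasurable (fun t => ‖force L (trajectory n L x t)‖)
      (volume.restrict {t : ℝ | 0 < t ∧ (t : EReal) < exitTime n L x}) ∧
    ∫⁻ t in {t : ℝ | 0 < t ∧ (t : EReal) < exitTime n L x},
      ENNReal.ofReal ‖force L (trajectory n L x t)‖ = ∫⁻ t in Ioi (0 : ℝ), speed n hR L t x := by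
  have hD : MeasurableSet (Ioi 0 ∩ flowDomain n L x) :=
    measurableSet_Ioi.inter (isOpen_flowDomain n L x).measurableSet
  have hsp := measurable_speed_apply hR L x
  rw [setOf_lt_exitTime hR hL hx]
  constructor
  · refine hsp.ennreal_toReal.aestronglyMeasurable.congr ?_
    filter_upwards [ae_restrict_mem hD] with t ht
    rw [speed_eq_of_mem_flowDomain hR hL hx (le_of_lt ht.1) ht.2, ENNReal.toReal_ofReal (norm_nonneg _)]
  · rw [← lintegral_indicator hD, ← lintegral_indicator measurableSet_Ioi]
    refine lintegral_congr fun t => ?_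
    by_cases h0 : t ∈ Ioi (0 : ℝ)
    · by_cases ht : t ∈ flowDomain n L x
      · rw [indicator_of_mem h0, indicator_of_mem (mem_inter h0 ht),
          speed_eq_of_mem_flowDomain hR hL hx (le_of_lt h0) ht]
      · rw [indicator_of_mem h0, indicator_of_notMem fun h => ht h.2,
          speed_eq_zero_of_notMem_flowDomain hR hL hx (le_of_lt h0) ht]
    · rw [indicator_of_notMem h0, indicator_of_notMem fun h => h0 h.1]

theorem flowLength_eq_toReal (hR : 0 < radius n) (hL : ∀ z ∈ L, ‖z‖ = radius n)
    (hx : x ∈ sphereN n \ L) :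
    flowLength n L x = (∫⁻ t in Ioi (0 : ℝ), speed n hR L t x).toReal := by
  obtain ⟨hm, h⟩ := setLIntegral_norm_force_trajectory hR hL hx
  rw [flowLength, integral_eq_lintegral_of_nonneg_ae (Filter.Eventually.of_forall fun t =>
    norm_nonneg _) hm, h]

end Length

end GravAlloc

/-! ### Assembly of the theorem. -/

theorem mainTheorem8 (n : ℕ) (hn : 0 < n) (L : Finset GravAlloc.E3)
    (hL : (L : Set GravAlloc.E3) ⊆ GravAlloc.sphereN n) (hcard : L.card = n) :
    (∀ x ∈ GravAlloc.sphereN n \ (L : Set GravAlloc.E3),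
      0 < GravAlloc.exitTime n L x ∧
      GravAlloc.IsMaximalFlowCurve n L x (GravAlloc.trajectory n L x)
        {t : ℝ | (t : EReal) < GravAlloc.exitTime n L x}) ∧
    Integrable (fun x => ‖GravAlloc.force L x‖) (GravAlloc.area n) ∧
    (∀ᵐ x ∂(GravAlloc.area n),
      IntegrableOn (fun t : ℝ => ‖GravAlloc.force L (GravAlloc.trajectory n L x t)‖)
        {t : ℝ | 0 < t ∧ (t : EReal) < GravAlloc.exitTime n L x}) ∧
    Integrable (GravAlloc.flowLength n L) (GravAlloc.area n) ∧
    (1 / (n : ℝ)) * ∫ x, GravAlloc.flowLength n L x ∂(GravAlloc.area n) =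
      (1 / (2 * Real.pi * n)) * ∫ x, ‖GravAlloc.force L x‖ ∂(GravAlloc.area n) := by
  have hR := GravAlloc.radius_pos hn
  have hL' : ∀ z ∈ L, ‖z‖ = GravAlloc.radius n := fun z hz => GravAlloc.norm_of_mem_sphereN (hL hz)
  -- The radius satisfies `R² = n / (4π)` and `L` has exactly `n` points; this fixes the expansion
  -- rate at `2π`.
  have hc : (L.card : ℝ) / (2 * GravAlloc.radius n ^ 2) = 2 * Real.pi := by
    have : (0 : ℝ) < n := by exact_mod_cast hn
    rw [hcard, GravAlloc.radius, Real.sq_sqrt (by positivity)]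
    field_simp
    norm_num
  have hae : ∀ᵐ x ∂(GravAlloc.area n), x ∈ GravAlloc.sphereN n \ (L : Set GravAlloc.E3) := by
    filter_upwards [GravAlloc.ae_mem_sphereN n, GravAlloc.ae_notMem_finset hR L] with x h1 h2
      using ⟨h1, h2⟩
  have hforce : (fun x => ‖GravAlloc.force L x‖) =ᵐ[GravAlloc.area n]
      fun x => ‖GravAlloc.coneField (GravAlloc.radius n) L x‖ := by
    filter_upwards [hae] with x hx
    rw [GravAlloc.force_eq_coneField hR hL' (GravAlloc.norm_of_mem_sphereN hx.1) hx.2]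
  have hconem := (GravAlloc.measurable_coneField (GravAlloc.radius n) L).norm
  have hfin := GravAlloc.lintegral_norm_coneField_lt_top hR hL'
  have hcone : Integrable (fun x => ‖GravAlloc.coneField (GravAlloc.radius n) L x‖)
      (GravAlloc.area n) :=
    ⟨hconem.aestronglyMeasurable, (hasFiniteIntegral_iff_ofReal
      (Filter.Eventually.of_forall fun x => norm_nonneg _)).2 hfin⟩
  have hJm : Measurable fun x => ∫⁻ t in Set.Ioi (0 : ℝ), GravAlloc.speed n hR L t x :=
    Measurable.lintegral_prod_left' (GravAlloc.measurable_speed hR L)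
  have hJ := GravAlloc.lintegral_lintegral_speed hR hL' (hcard ▸ hn)
  rw [hc] at hJ
  have hJfin : ∫⁻ x, ∫⁻ t in Set.Ioi (0 : ℝ), GravAlloc.speed n hR L t x ∂volume ∂(GravAlloc.area n) ≠ ⊤ := by
    rw [hJ]; exact ENNReal.mul_ne_top ENNReal.ofReal_ne_top hfin.ne
  have hlt := ae_lt_top hJm hJfin
  have hlen : GravAlloc.flowLength n L =ᵐ[GravAlloc.area n]
      fun x => (∫⁻ t in Set.Ioi (0 : ℝ), GravAlloc.speed n hR L t x).toReal := by
    filter_upwards [hae] with x hx using GravAlloc.flowLength_eq_toReal hR hL' hx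
  refine ⟨fun x hx => GravAlloc.isMaximalFlowCurve_trajectory hR hL' hx,
    hcone.congr hforce.symm, ?_, ?_, ?_⟩
  · filter_upwards [hae, hlt] with x hx hx'
    obtain ⟨hm, h⟩ := GravAlloc.setLIntegral_norm_force_trajectory hR hL' hx
    exact ⟨hm, (hasFiniteIntegral_iff_ofReal
      (Filter.Eventually.of_forall fun x => norm_nonneg _)).2 (h ▸ hx')⟩
  · exact (integrable_toReal_of_lintegral_ne_top hJm.aemeasurable hJfin).congr hlen.symm
  · rw [integral_congr_ae hlen, integral_congr_ae hforce, integral_toReal hJm.aemeasurable hlt, hJ,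
      integral_eq_lintegral_of_nonneg_ae (Filter.Eventually.of_forall fun x => norm_nonneg _)
        hconem.aestronglyMeasurable, ENNReal.toReal_mul,
      ENNReal.toReal_ofReal (by positivity)]
    ring
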